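/- Let $R$ be a local domain whose residue field has characteristic $0$. Let $S/R$ be a simple extension of degree $n$: $S$ is a commutative ring containing $R$ (via an injective ring homomorphism $R\to S$), and there is a unit $c\in S^*$ such that $1,c,\dots,c^{n-1}$ is a basis of $S$ as an $R$-module (equivalently, $n\ge 1$ and $S\cong R[t]/(p)$ with $p$ monic of degree $n$ and $p(0)\in R^*$). Let $N^S_R:S\to R$ be the norm map, where $N^S_R(s)$ is the determinant of multiplication by $s$ on the free $R$-module $S$. Let $q$ be a regular quadratic form over $R$ on a free module of finite rank $m$, i.e. the bilinear form $q(x+y)-q(x)-q(y)$ induces an isomorphism of the module with its dual. Let $q_S=q\otimes_R S$ be the base change of $q$ to $S$, let $D(q_S)\subset S^*$ be the subgroup generated by all units of $S$ of the form $q_S(x)$, and let $D(q)\subset R^*$ be the subgroup generated by all units of $R$ of the form $q(x)$. Then $$N^S_R(D(q_S))\subset D(q).$$ -/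

import Mathlib

open scoped TensorProduct

/-- In a local ring whose residue field has characteristic zero, `2` is invertible.
(`Invertible (2 : R)` is a subsingleton; this instance is what the base change of
quadratic forms requires.) -/
noncomputable instance invertibleTwoOfCharZeroResidueField (R : Type*) [CommRing R] [IsLocalRing R]
    [CharZero (IsLocalRing.ResidueField R)] : Invertible (2 : R) :=
  IsUnit.invertible <| by
    by_contra h
    have h1 : IsLocalRing.residue R 2 = 0 := by
      rw [IsLocalRing.residue_eq_zero_iff]
      exact h
    rw [map_ofNat] at h1
    exact two_ne_zero h1

/-- `S` is a simple extension of `R` of degree `n`: `R → S` is injective, and there is a unit `c`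
of `S` (a primitive element) such that `1, c, …, c ^ (n - 1)` is a basis of the `R`-module `S`. -/
def IsSimpleExtension (R S : Type*) [CommRing R] [CommRing S] [Algebra R S] (n : ℕ) : Prop :=
  Function.Injective (algebraMap R S) ∧
    ∃ c : Sˣ, ∃ b : Module.Basis (Fin n) R S, ∀ i : Fin n, b i = (c : S) ^ (i : ℕ)

/-- A quadratic form on `M` is regular if its polar bilinear form `q (x + y) - q x - q y` induces
an isomorphism from `M` to its dual. -/
def QuadraticForm.IsRegular {R M : Type*} [CommRing R] [AddCommGroup M] [Module R M]
    (q : QuadraticForm R M) : Prop :=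
  Function.Bijective (QuadraticMap.polarBilin q : M →ₗ[R] Module.Dual R M)

/-- `D(q)`: the subgroup of the unit group generated by the units represented by `q`. -/
def QuadraticForm.valueGroup {A M : Type*} [CommRing A] [AddCommGroup M] [Module A M]
    (q : QuadraticForm A M) : Subgroup Aˣ :=
  Subgroup.closure {u : Aˣ | ∃ x : M, q x = (u : A)}

/-!
Let `z = ∑ sᵢ ⊗ mᵢ` with `x = q_S(z)` a unit, and let `Q` be the quadratic form over `R` with Gram
matrix that of the `mᵢ`, so that `x = Q(s)`. Replacing `s` by `y s` changes `x` into `x y²` and its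
norm by the square of a unit of `R`, which lies in `D(q)`; for generic `y` the powers of `x` form a
basis of `S`. Then `S = R[X] / (P)` with `x` the class of `X`, `P` divides `Q(v) - X` for some
polynomials `v` of degree less than `n`, and `N(x) = (-1)ⁿ P(0)`.

That `(-1)ⁿ P(0)` lies in `D(q)` is proved by a descent on `n`. The polynomial `Q(v) - X` has degree
at most `2 (n - 1)`, so it is `P * c * g` with `g` monic of degree `n - 2`, provided the vector of
coefficients of `X ^ (n - 1)` in `v` has a unit as its value. That value is `c`, and the value at
the vector of constant coefficients is `P(0) * c * g(0)`; hence `P(0) g(0)` lies in `D(q)`, and `g`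
satisfies the same hypothesis as `P`.

The two values are made units by one more change `x ↦ x y²` with `y` generic. Being a unit is a
polynomial condition on `y` modulo the maximal ideal. As the residue field is infinite, it is enough
to satisfy each condition once over an algebraically closed extension of that field, where it is
checked at the conjugates of `x`. This needs `P` separable. To arrange that, `P` is first replaced
by its cofactor in `Q(v + P w) - X`, of the same degree, for a generic constant vector `w`.
-/

open Polynomial Matrix Finset

section FormOver

variable {R A B ι : Type*} [CommRing R] [CommRing A] [CommRing B] [Algebra R A] [Algebra R B]
  [Fintype ι] [DecidableEq ι]

/-- The quadratic form `x ↦ ∑ i j, x i * a i j * x j` over an `R`-algebra `A`, where `a` is a matrix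
over `R`. The matrix need not be symmetric. Keeping `A` as a parameter makes the form natural in
`A`, which is how values over `A = R[X]` and over extensions of the residue field are compared. -/
def formOver (A : Type*) [CommRing A] [Algebra R A] (a : Matrix ι ι R) : QuadraticForm A (ι → A) :=
  (toBilin' (a.map (algebraMap R A))).toQuadraticMap

variable (a : Matrix ι ι R)

theorem formOver_apply (x : ι → A) :
    formOver A a x = ∑ i, ∑ j, x i * algebraMap R A (a i j) * x j := by
  simp only [formOver, LinearMap.BilinMap.toQuadraticMap_apply, toBilin'_apply, map_apply]

theorem map_formOver (φ : A →ₐ[R] B) (x : ι → A) :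
    φ (formOver A a x) = formOver B a (φ ∘ x) := by
  simp only [formOver_apply, map_sum, map_mul, AlgHom.commutes, Function.comp_apply]

theorem map_polar_formOver (φ : A →ₐ[R] B) (x y : ι → A) :
    φ (QuadraticMap.polar (formOver A a) x y) =
      QuadraticMap.polar (formOver B a) (φ ∘ x) (φ ∘ y) := by
  have comp_add : φ ∘ (x + y) = φ ∘ x + φ ∘ y := funext fun i => map_add φ (x i) (y i)
  simp only [QuadraticMap.polar, map_sub, map_formOver, comp_add]

theorem eval_formOver (v : ι → A[X]) (r : A) :
    (formOver A[X] a v).eval r = formOver A a fun l => (v l).eval r :=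
  map_formOver a ((aeval r).restrictScalars R) v

theorem dvd_formOver_sub {p : A} {v w : ι → A} (h : ∀ l, p ∣ v l - w l) :
    p ∣ formOver A a v - formOver A a w := by
  let π := Ideal.Quotient.mkₐ R (Ideal.span {p})
  have hπ : π ∘ v = π ∘ w := funext fun l =>
    Ideal.Quotient.eq.mpr (Ideal.mem_span_singleton.mpr (h l))
  rw [← Ideal.mem_span_singleton, ← Ideal.Quotient.eq]
  exact (map_formOver a π v).trans ((congrArg _ hπ).trans (map_formOver a π w).symm)

theorem map_dvd_formOver_sub_X (φ : A →ₐ[R] B) {p : A[X]} {v : ι → A[X]}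
    (hv : p ∣ formOver A[X] a v - X) :
    p.map (φ : A →+* B) ∣ formOver B[X] a (fun l => (v l).map (φ : A →+* B)) - X := by
  have := map_dvd (mapAlgHom φ) hv
  rwa [map_sub, map_formOver, coe_mapAlgHom, map_X] at this

theorem natDegree_formOver_le {v : ι → A[X]} {d : ℕ} (hv : ∀ l, (v l).natDegree ≤ d) :
    (formOver A[X] a v).natDegree ≤ d + d := by
  rw [formOver_apply]
  refine natDegree_sum_le_of_forall_le _ _ fun i _ => natDegree_sum_le_of_forall_le _ _ fun j _ =>
    natDegree_mul_le_of_le ?_ (hv j)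
  rw [Polynomial.algebraMap_apply]
  exact (natDegree_mul_C_le _ _).trans (hv i)

theorem coeff_formOver {v : ι → A[X]} {d : ℕ} (hv : ∀ l, (v l).natDegree ≤ d) :
    (formOver A[X] a v).coeff (d + d) = formOver A a fun l => (v l).coeff d := by
  simp only [formOver_apply, finsetSum_coeff]
  refine sum_congr rfl fun i _ => sum_congr rfl fun j _ => ?_
  rw [Polynomial.algebraMap_apply,
    coeff_mul_add_eq_of_natDegree_le ((natDegree_mul_C_le _ _).trans (hv i)) (hv j), coeff_mul_C]

end FormOver

section ValueMonoid

variable {A M : Type*} [CommRing A] [AddCommGroup M] [Module A M]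

/-- The group `D(q)` viewed inside `A`. Statements about it need no bundled units. -/
def valueMonoid (q : QuadraticForm A M) : Submonoid A :=
  q.valueGroup.toSubmonoid.map (Units.coeHom A)

theorem apply_mem_valueMonoid {q : QuadraticForm A M} {x : M} (h : IsUnit (q x)) :
    q x ∈ valueMonoid q :=
  ⟨h.unit, Subgroup.subset_closure ⟨x, rfl⟩, rfl⟩

theorem mem_valueMonoid_of_mul_mem {q : QuadraticForm A M} {r s : A} (hr : r ∈ valueMonoid q)
    (hrs : r * s ∈ valueMonoid q) : s ∈ valueMonoid q := by
  obtain ⟨u, hu, rfl⟩ := hr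
  obtain ⟨w, hw, hws⟩ := hrs
  refine ⟨u⁻¹ * w, q.valueGroup.mul_mem (q.valueGroup.inv_mem hu) hw, ?_⟩
  rw [map_mul, hws, ← mul_assoc, ← map_mul, inv_mul_cancel, map_one, one_mul]

theorem sq_mem_valueMonoid {q : QuadraticForm A M} {x : M} (hx : IsUnit (q x)) {r : A}
    (hr : IsUnit r) : r ^ 2 ∈ valueMonoid q := by
  have hrx : IsUnit (q (r • x)) := by
    rw [QuadraticMap.map_smul]
    exact (hr.mul hr).mul hx
  refine mem_valueMonoid_of_mul_mem (apply_mem_valueMonoid hx) ?_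
  rw [mul_comm, sq, ← smul_eq_mul, ← QuadraticMap.map_smul]
  exact apply_mem_valueMonoid hrx

end ValueMonoid

universe u

section GenericUnit

variable {R : Type u} [CommRing R] [IsLocalRing R] {σ : Type}

/-- A function on `R ^ σ` is generically a unit if it is a polynomial function given by a polynomial
whose reduction modulo the maximal ideal is nonzero. When the residue field is infinite, finitely
many such functions take unit values at a common point. -/
def IsGenericallyUnit (f : (σ → R) → R) : Prop :=
  ∃ F : MvPolynomial σ R, (∀ y, MvPolynomial.eval y F = f y) ∧ F.map (IsLocalRing.residue R) ≠ 0

theorem IsGenericallyUnit.mul {f g : (σ → R) → R} (hf : IsGenericallyUnit f)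
    (hg : IsGenericallyUnit g) : IsGenericallyUnit fun y => f y * g y := by
  obtain ⟨F, hF, hF0⟩ := hf
  obtain ⟨G, hG, hG0⟩ := hg
  refine ⟨F * G, fun y => by rw [map_mul, hF, hG], ?_⟩
  rw [map_mul]
  exact mul_ne_zero hF0 hG0

theorem IsGenericallyUnit.exists_isUnit [Infinite (IsLocalRing.ResidueField R)]
    {f : (σ → R) → R} (hf : IsGenericallyUnit f) : ∃ y, IsUnit (f y) := by
  obtain ⟨F, hF, hF0⟩ := hf
  obtain ⟨w, hw⟩ : ∃ w, MvPolynomial.eval w (F.map (IsLocalRing.residue R)) ≠ 0 := by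
    contrapose! hF0
    exact MvPolynomial.funext fun w => by rw [hF0, map_zero]
  choose y hy using fun i => IsLocalRing.residue_surjective (w i)
  obtain rfl : IsLocalRing.residue R ∘ y = w := funext hy
  rw [← MvPolynomial.map_eval, hF, IsLocalRing.residue_ne_zero_iff_isUnit] at hw
  exact ⟨y, hw⟩

/-- The polynomial is the value of `t` at the generic point of `R ^ σ`. -/
theorem isGenericallyUnit_of_natural (t : ∀ (B : Type u) [CommRing B] [Algebra R B], (σ → B) → B)
    (map_t : ∀ {B C : Type u} [CommRing B] [CommRing C] [Algebra R B] [Algebra R C]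
      (φ : B →ₐ[R] C) (y : σ → B), φ (t B y) = t C (φ ∘ y))
    {K : Type u} [Field K] [Algebra R K] [IsLocalHom (algebraMap R K)] {y : σ → K}
    (hy : t K y ≠ 0) : IsGenericallyUnit (t R) := by
  have aeval_t (B : Type u) [CommRing B] [Algebra R B] (z : σ → B) :
      MvPolynomial.aeval z (t (MvPolynomial σ R) MvPolynomial.X) = t B z := by
    rw [map_t]
    exact congrArg _ (funext fun i => MvPolynomial.aeval_X z i)
  refine ⟨t _ MvPolynomial.X, fun z => aeval_t R z, fun h0 => hy ?_⟩
  rw [← aeval_t, MvPolynomial.aeval_def, MvPolynomial.eval₂_eq]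
  refine sum_eq_zero fun d _ => mul_eq_zero_of_left ?_ _
  by_contra hd
  have hu := isUnit_of_map_unit (algebraMap R K) _ (IsUnit.mk0 _ hd)
  rw [← IsLocalRing.residue_ne_zero_iff_isUnit, ← MvPolynomial.coeff_map, h0] at hu
  exact hu (MvPolynomial.coeff_zero d)

end GenericUnit

section CoordDet

variable {R A B : Type*} [CommRing R] [CommRing A] [CommRing B] [Algebra R A] [Algebra R B] {n : ℕ}

/-- The determinant of the coordinates of `g 0, …, g (n - 1)` in the basis `1, X, …, X ^ (n - 1)` of
`A[X] / (p)`, where `p` is monic of degree `n`. The degree `n` is a separate argument because it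
does not change when `p` is mapped to another ring. -/
noncomputable def coordDet (n : ℕ) (p : A[X]) (g : Fin n → A[X]) : A :=
  (Matrix.of fun i j : Fin n => (g j %ₘ p).coeff i).det

theorem map_algHom_map_algebraMap (φ : A →ₐ[R] B) (f : R[X]) :
    (f.map (algebraMap R A)).map (φ : A →+* B) = f.map (algebraMap R B) := by
  rw [Polynomial.map_map, AlgHom.comp_algebraMap]

theorem map_coordDet (φ : A →ₐ[R] B) {p : R[X]} (hp : p.Monic) (g : Fin n → A[X]) :
    φ (coordDet n (p.map (algebraMap R A)) g) =
      coordDet n (p.map (algebraMap R B)) fun j => (g j).map (φ : A →+* B) := by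
  simp only [coordDet, AlgHom.map_det, AlgHom.mapMatrix_apply, ← map_algHom_map_algebraMap φ,
    ← map_modByMonic _ (hp.map (algebraMap R A))]
  congr 1
  ext i j
  simp only [map_apply, of_apply, coeff_map, RingHom.coe_coe]

theorem coordDet_congr {p : A[X]} (hp : p.Monic) {g h : Fin n → A[X]}
    (hgh : ∀ j, p ∣ g j - h j) : coordDet n p g = coordDet n p h := by
  simp only [coordDet, modByMonic_eq_of_dvd_sub hp (hgh _)]

theorem coordDet_eq_one [Nontrivial A] {p : A[X]} (hp : p.Monic) (hn : p.natDegree = n)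
    {g : Fin n → A[X]} (monic_g : ∀ j, (g j).Monic) (natDegree_g : ∀ j, (g j).natDegree = j) :
    coordDet n p g = 1 := by
  have mod_g (j) : g j %ₘ p = g j := by
    refine (modByMonic_eq_self_iff hp).mpr (degree_lt_degree ?_)
    rw [natDegree_g, hn]
    exact j.isLt
  simp only [coordDet, mod_g]
  exact det_matrixOfPolynomials g natDegree_g monic_g

theorem coordDet_mul_det_vandermonde (p : A[X]) (r : Fin n → A)
    (hp : p.Monic) (hn : p.natDegree = n) (hr : ∀ i, p.IsRoot (r i)) (g : Fin n → A[X]) :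
    coordDet n p g * (vandermonde r).det = (Matrix.of fun i j => (g j).eval (r i)).det := by
  nontriviality A
  rw [coordDet, mul_comm, ← det_mul]
  congr 1
  ext i j
  have eval_mod : (g j %ₘ p).eval (r i) = (g j).eval (r i) := by
    conv_rhs => rw [← modByMonic_add_div (g j) p]
    rw [eval_add, eval_mul, (hr i).eq_zero, zero_mul, add_zero]
  have mod_mem : g j %ₘ p ∈ degreeLT A n := by
    rw [mem_degreeLT, ← hn, ← degree_eq_natDegree hp.ne_zero]
    exact degree_modByMonic_lt _ hp
  rw [of_apply, ← eval_mod, eval_eq_sum_degreeLTEquiv mod_mem, mul_apply]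
  exact sum_congr rfl fun k _ => mul_comm _ _

/-- The polynomial of degree less than `n` with coefficients `y 0, …, y (n - 1)`. -/
noncomputable def polyOfCoeffs (y : Fin n → A) : A[X] := ∑ i, C (y i) * X ^ (i : ℕ)

theorem map_polyOfCoeffs (f : A →+* B) (y : Fin n → A) :
    (polyOfCoeffs y).map f = polyOfCoeffs (f ∘ y) := by
  simp only [polyOfCoeffs, Polynomial.map_sum, Polynomial.map_mul, Polynomial.map_pow, map_C,
    map_X, Function.comp_apply]

theorem coeff_polyOfCoeffs (y : Fin n → A) (j : Fin n) : (polyOfCoeffs y).coeff j = y j := by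
  simp [polyOfCoeffs, coeff_X_pow, Fin.val_inj]

theorem exists_eq_polyOfCoeffs {f : A[X]} (hf : f.degree < n) :
    ∃ y : Fin n → A, polyOfCoeffs y = f :=
  ⟨fun i => f.coeff i, (sum_fin (fun i c => C c * X ^ i) (by simp) hf).trans
    f.as_sum_support_C_mul_X_pow.symm⟩

end CoordDet

section IsAdjoinRootMonic

variable {R S : Type*} [CommRing R] [CommRing S] [Algebra R S] {p : R[X]}
  (h : IsAdjoinRootMonic S p)

theorem isUnit_map_iff_isCoprime (h : IsAdjoinRoot S p) {f : R[X]} :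
    IsUnit (h.map f) ↔ IsCoprime f p := by
  refine ⟨fun hf => ?_, fun ⟨b, c, hbc⟩ => ?_⟩
  · obtain ⟨z, hz⟩ := hf.exists_left_inv
    obtain ⟨b, rfl⟩ := h.map_surjective z
    rw [← map_mul, ← map_one h.map, ← sub_eq_zero, ← map_sub, h.map_eq_zero_iff] at hz
    obtain ⟨c, hc⟩ := hz
    exact ⟨b, -c, by linear_combination hc⟩
  · refine .of_mul_eq_one_right (h.map b) ?_
    rw [← map_mul, ← map_one h.map, ← hbc, map_add, map_mul _ c, h.map_self, mul_zero, add_zero]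

theorem basis_det_map (g : Fin p.natDegree → R[X]) :
    h.basis.det (fun j => h.map (g j)) = coordDet p.natDegree p g := by
  rw [Module.Basis.det_apply, coordDet]
  congr 1
  ext i j
  rw [Module.Basis.toMatrix_apply, h.basis_repr, h.modByMonicHom_map, of_apply]

theorem basis_det_update_map (g : Fin p.natDegree → R[X]) (j : Fin p.natDegree) (f : R[X]) :
    h.basis.det (Function.update (fun i => h.map (g i)) j (h.map f)) =
      coordDet p.natDegree p (Function.update g j f) := by
  rw [← basis_det_map h]
  exact congrArg _ (Function.comp_update h.map g j f).symm

theorem basis_det_mul_eq_norm (x : S) :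
    h.basis.det (fun j => x * h.basis j) = Algebra.norm R x := by
  have := h.basis.det_comp (Algebra.lmul R S x) h.basis
  rwa [h.basis.det_self, mul_one, ← Algebra.norm_apply] at this

theorem minpoly_root [Nontrivial R] : minpoly R h.root = p := by
  have := h.finite
  have : Module.Free R S := .of_basis h.basis
  let h' := IsAdjoinRootMonic.mkOfAdjoinEqTop' h.adjoin_root_eq_top
  refine eq_of_monic_of_dvd_of_natDegree_le h.monic h'.monic ?_ ?_
  · rw [← h.map_eq_zero_iff, ← h.aeval_root_eq_map, minpoly.aeval]
  · rw [← h.finrank, ← h'.finrank]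

theorem norm_root [Nontrivial R] : Algebra.norm R h.root = (-1) ^ p.natDegree * p.coeff 0 := by
  have := Algebra.PowerBasis.norm_gen_eq_coeff_zero_minpoly h.powerBasis
  rwa [h.powerBasis_gen, h.powerBasis_dim, minpoly_root] at this

theorem exists_change_root [Nontrivial R] {ι : Type*} [Fintype ι] [DecidableEq ι]
    (a : Matrix ι ι R) {s : ι → S}
    (hs : IsUnit (h.basis.det fun j => formOver S a s ^ (j : ℕ))) :
    ∃ (P : R[X]) (v : ι → R[X]), P.Monic ∧ P.natDegree = p.natDegree ∧ P ∣ formOver R[X] a v - X ∧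
      (-1) ^ p.natDegree * P.coeff 0 = Algebra.norm R (formOver S a s) ∧
      (∀ l, (v l).degree < p.natDegree) ∧
      ∀ j : Fin p.natDegree, h.basis.det (fun i => formOver S a s ^ (i : ℕ)) ^ 2 *
          formOver R a (fun l => (v l).coeff j) =
        formOver R a fun l =>
          h.basis.det (Function.update (fun i => formOver S a s ^ (i : ℕ)) j (s l)) := by
  set T := formOver S a s
  obtain ⟨li, span_eq⟩ := h.basis.is_basis_iff_det.mpr hs
  set b := Module.Basis.mk li span_eq.ge
  have := h.finite
  have : Module.Free R S := .of_basis h.basis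
  have adjoin_T : Algebra.adjoin R {T} = ⊤ := by
    refine top_unique fun z _ => ?_
    have z_mem : z ∈ Submodule.span R (Set.range fun j : Fin p.natDegree => T ^ (j : ℕ)) :=
      span_eq ▸ Submodule.mem_top
    refine Submodule.span_le (p := (Algebra.adjoin R {T}).toSubmodule).mpr ?_ z_mem
    rintro _ ⟨j, rfl⟩
    exact pow_mem (Algebra.self_mem_adjoin_singleton R T) _
  let h' := IsAdjoinRootMonic.mkOfAdjoinEqTop' adjoin_T
  have root_h' : h'.root = T := IsAdjoinRootMonic.mkOfAdjoinEqTop'_root adjoin_T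
  have natDegree_P : (minpoly R T).natDegree = p.natDegree := by
    rw [← h.finrank, h'.finrank]
  have map_polyOfCoeffs_repr (z : S) : h'.map (polyOfCoeffs (b.repr z)) = z := by
    rw [← h'.aeval_root_eq_map, root_h', polyOfCoeffs]
    simpa [Algebra.smul_def, b] using b.sum_repr z
  refine ⟨minpoly R T, fun l => polyOfCoeffs (b.repr (s l)), h'.monic, natDegree_P, ?_, ?_,
    fun l => degree_sum_fin_lt _, fun j => ?_⟩
  · rw [← h'.map_eq_zero_iff, map_sub, map_formOver, h'.map_X, root_h', sub_eq_zero]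
    exact congrArg (formOver S a) (funext fun l => map_polyOfCoeffs_repr (s l))
  · rw [← natDegree_P, ← norm_root h', root_h']
  · rw [sq, ← smul_eq_mul, ← QuadraticMap.map_smul]
    refine congrArg _ (funext fun l => ?_)
    rw [Pi.smul_apply, coeff_polyOfCoeffs]
    exact congr($(h.basis.det_smul_mk_coord_eq_det_update li span_eq.ge j) (s l))

end IsAdjoinRootMonic

section SquareRoot

variable {K L : Type*} [Field K] [IsAlgClosed K] [CommRing L] [Algebra K L]

theorem exists_isNilpotent_sq_sub [Module.Finite K L] (u : L) :
    ∃ z : L, IsNilpotent (z ^ 2 - u) := by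
  have : IsArtinianRing L := .of_finite K L
  have exists_sqrt (I : MaximalSpectrum L) :
      ∃ t : L ⧸ I.asIdeal, t ^ 2 = Ideal.Quotient.mk I.asIdeal u := by
    obtain ⟨c, hc⟩ := (IsAlgClosed.algebraMap_bijective_of_isIntegral (k := K)
      (K := L ⧸ I.asIdeal)).surjective (Ideal.Quotient.mk I.asIdeal u)
    obtain ⟨s, hs⟩ := IsAlgClosed.exists_pow_nat_eq c two_pos
    exact ⟨algebraMap K _ s, by rw [← map_pow, hs, hc]⟩
  choose t ht using exists_sqrt
  let e := IsArtinianRing.quotNilradicalEquivPi L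
  obtain ⟨z, hz⟩ := Ideal.Quotient.mk_surjective (e.symm t)
  refine ⟨z, ?_⟩
  rw [← mem_nilradical, ← Ideal.Quotient.eq, map_pow, hz, ← map_pow, e.symm_apply_eq]
  exact funext ht

theorem isSquare_of_isNilpotent_sq_sub {L : Type*} [CommRing L] {u z : L} (h2 : IsUnit (2 : L))
    (hu : IsUnit u) (hz : IsNilpotent (z ^ 2 - u)) : IsSquare u := by
  have isUnit_z : IsUnit z := by
    rw [← isUnit_pow_iff two_ne_zero, ← add_sub_cancel u (z ^ 2)]
    exact hz.isUnit_add_left_of_commute hu (Commute.all _ _)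
  obtain ⟨r, ⟨-, hr⟩, -⟩ := existsUnique_nilpotent_sub_and_aeval_eq_zero
    (P := X ^ 2 - C u) (x := z) (by simpa using hz)
    (by simpa [one_add_one_eq_two] using h2.mul isUnit_z)
  refine ⟨r, ?_⟩
  rw [← sq, eq_comm, ← sub_eq_zero]
  simpa using hr

theorem isSquare_of_isUnit [NeZero (2 : K)] [Module.Finite K L] {u : L} (hu : IsUnit u) :
    IsSquare u := by
  obtain ⟨z, hz⟩ := exists_isNilpotent_sq_sub (K := K) u
  refine isSquare_of_isNilpotent_sq_sub ?_ hu hz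
  rw [← map_ofNat (algebraMap K L) 2]
  exact (IsUnit.mk0 (2 : K) two_ne_zero).map (algebraMap K L)

theorem exists_dvd_sq_sub [NeZero (2 : K)] {p f : K[X]} (hp : p.Monic) (hf : IsCoprime f p) :
    ∃ Y, p ∣ Y ^ 2 - f := by
  have := hp.finite_adjoinRoot
  obtain ⟨z, hz⟩ := isSquare_of_isUnit (K := K)
    ((isUnit_map_iff_isCoprime (AdjoinRoot.isAdjoinRoot p)).mpr hf)
  obtain ⟨Y, rfl⟩ := AdjoinRoot.mk_surjective z
  refine ⟨Y, ?_⟩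
  rw [← AdjoinRoot.mk_eq_mk, map_pow, sq]
  exact hz.symm

end SquareRoot

section Generator

variable {n : ℕ}

theorem exists_coordDet_mul_sq_pow_ne_zero {K : Type*} [Field K] [IsAlgClosed K] [NeZero (2 : K)]
    {p x : K[X]} (hp : p.Monic) (hn : p.natDegree = n) (hx : IsCoprime x p) :
    ∃ y : Fin n → K, coordDet n p (fun j => (x * polyOfCoeffs y ^ 2) ^ (j : ℕ)) ≠ 0 := by
  obtain ⟨c, hc⟩ := exists_eval_ne_zero_of_natDegree_lt_card p hp.ne_zero
    ((Cardinal.natCast_lt_aleph0).trans_le (Cardinal.aleph0_le_mk K))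
  obtain ⟨b, d, hbd⟩ := id hx
  have coprime_linear : IsCoprime (X - C c) p := by
    rw [(irreducible_X_sub_C c).coprime_iff_not_dvd, dvd_iff_isRoot]
    exact hc
  have coprime_b : IsCoprime b p := ⟨x, d, by linear_combination hbd⟩
  obtain ⟨Y, hY⟩ := exists_dvd_sq_sub hp (coprime_b.mul_left coprime_linear)
  obtain ⟨y, hy⟩ := exists_eq_polyOfCoeffs (n := n) (f := Y %ₘ p)
    (by rw [← hn, ← degree_eq_natDegree hp.ne_zero]; exact degree_modByMonic_lt _ hp)
  have dvd_Y : p ∣ polyOfCoeffs y - Y := by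
    rw [hy, modByMonic_eq_sub_mul_div, sub_sub_cancel_left]
    exact (dvd_mul_right _ _).neg_right
  have dvd_generator : p ∣ x * polyOfCoeffs y ^ 2 - (X - C c) := by
    have generator_sub_eq : x * polyOfCoeffs y ^ 2 - (X - C c) =
        (polyOfCoeffs y - Y) * (x * (polyOfCoeffs y + Y)) +
          (Y ^ 2 - b * (X - C c)) * x - p * (d * (X - C c)) := by
      linear_combination (X - C c) * hbd
    rw [generator_sub_eq]
    exact ((dvd_Y.mul_right _).add (hY.mul_right _)).sub (dvd_mul_right _ _)
  refine ⟨y, ?_⟩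
  rw [coordDet_congr hp fun j => dvd_generator.trans (sub_dvd_pow_sub_pow _ _ _),
    coordDet_eq_one hp hn (fun j => (monic_X_sub_C c).pow _) fun j => by
      rw [natDegree_pow, natDegree_X_sub_C, mul_one]]
  exact one_ne_zero

variable {R : Type u} [CommRing R] [IsLocalRing R] [CharZero (IsLocalRing.ResidueField R)]

variable (R) in
theorem exists_isAlgClosed_isLocalHom : ∃ (K : Type u) (_ : Field K) (_ : IsAlgClosed K)
    (_ : CharZero K) (_ : Algebra R K), IsLocalHom (algebraMap R K) := by
  let k := IsLocalRing.ResidueField R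
  have : IsLocalHom (algebraMap R k) := inferInstanceAs (IsLocalHom (IsLocalRing.residue R))
  refine ⟨AlgebraicClosure k, inferInstance, inferInstance, inferInstance, inferInstance, ?_⟩
  rw [IsScalarTower.algebraMap_eq R k]
  exact RingHom.isLocalHom_comp _ _

theorem isGenericallyUnit_coordDet_mul_sq_pow {p x : R[X]} (hp : p.Monic) (hn : p.natDegree = n)
    (hx : IsCoprime x p) : IsGenericallyUnit fun y : Fin n → R =>
      coordDet n p fun j => (x * polyOfCoeffs y ^ 2) ^ (j : ℕ) := by
  obtain ⟨K, _, _, _, _, _⟩ := exists_isAlgClosed_isLocalHom R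
  obtain ⟨y, hy⟩ := exists_coordDet_mul_sq_pow_ne_zero (hp.map (algebraMap R K))
    ((hp.natDegree_map _).trans hn) (hx.map (mapRingHom (algebraMap R K)))
  let t (B : Type u) [CommRing B] [Algebra R B] (y : Fin n → B) : B :=
    coordDet n (p.map (algebraMap R B))
      fun j => (x.map (algebraMap R B) * polyOfCoeffs y ^ 2) ^ (j : ℕ)
  have isGenericallyUnit_t := isGenericallyUnit_of_natural t (fun φ y => by
    simp only [t, map_coordDet φ hp, Polynomial.map_pow, Polynomial.map_mul,
      map_algHom_map_algebraMap, map_polyOfCoeffs, RingHom.coe_coe]) hy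
  simpa only [t, Algebra.algebraMap_self, Polynomial.map_id] using isGenericallyUnit_t

theorem isGenericallyUnit_coordDet_mul_pow {p : R[X]} (hp : p.Monic) (hn : p.natDegree = n) :
    IsGenericallyUnit fun y : Fin n → R =>
      coordDet n p fun j => polyOfCoeffs y * X ^ (j : ℕ) := by
  obtain ⟨K, _, _, _, _, _⟩ := exists_isAlgClosed_isLocalHom R
  have monic_pK := hp.map (algebraMap R K)
  have natDegree_pK : (p.map (algebraMap R K)).natDegree = n := (hp.natDegree_map _).trans hn
  obtain ⟨y, hy⟩ := exists_eq_polyOfCoeffs (n := n) (f := 1 %ₘ p.map (algebraMap R K))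
    (by rw [← natDegree_pK, ← degree_eq_natDegree monic_pK.ne_zero]
        exact degree_modByMonic_lt _ monic_pK)
  have det_eq_one : coordDet n (p.map (algebraMap R K))
      (fun j => polyOfCoeffs y * X ^ (j : ℕ)) = 1 := by
    rw [coordDet_congr monic_pK (h := fun j => X ^ (j : ℕ)),
      coordDet_eq_one monic_pK natDegree_pK (fun j => monic_X_pow j) fun j => natDegree_X_pow j]
    intro j
    rw [← sub_one_mul, hy, modByMonic_eq_sub_mul_div, sub_sub_cancel_left]
    exact ((dvd_mul_right _ _).neg_right).mul_right _
  let t (B : Type u) [CommRing B] [Algebra R B] (y : Fin n → B) : B :=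
    coordDet n (p.map (algebraMap R B)) fun j => polyOfCoeffs y * X ^ (j : ℕ)
  have isGenericallyUnit_t := isGenericallyUnit_of_natural t (fun φ y => by
    simp only [t, map_coordDet φ hp, Polynomial.map_pow, Polynomial.map_mul, map_X,
      map_polyOfCoeffs, RingHom.coe_coe]) (det_eq_one.trans_ne one_ne_zero)
  simpa only [t, Algebra.algebraMap_self, Polynomial.map_id] using isGenericallyUnit_t

theorem exists_isUnit_norm_isUnit_basis_det {S : Type*} [CommRing S] [Algebra R S] {p : R[X]}
    (h : IsAdjoinRootMonic S p) {x : S} (hx : IsUnit x) :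
    ∃ y : S, IsUnit (Algebra.norm R y) ∧
      IsUnit (h.basis.det fun j => (x * y ^ 2) ^ (j : ℕ)) := by
  obtain ⟨f, rfl⟩ := h.map_surjective x
  have coprime_f := (isUnit_map_iff_isCoprime h.toIsAdjoinRoot).mp hx
  obtain ⟨y, hy⟩ := ((isGenericallyUnit_coordDet_mul_pow h.monic rfl).mul
    (isGenericallyUnit_coordDet_mul_sq_pow h.monic rfl coprime_f)).exists_isUnit
  obtain ⟨unit_norm, unit_det⟩ := IsUnit.mul_iff.mp hy
  refine ⟨h.map (polyOfCoeffs y), ?_, ?_⟩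
  · rw [← basis_det_mul_eq_norm h]
    simpa only [h.basis_apply, ← h.map_X, ← map_pow, ← map_mul, basis_det_map] using unit_norm
  · simpa only [← map_pow, ← map_mul, basis_det_map] using unit_det

end Generator

section CoefficientTest

theorem cramer_apply_of_row_eq {m R : Type*} [Fintype m] [DecidableEq m] [CommRing R]
    {A : Matrix m m R} {i k : m} (hik : i ≠ k) (hA : A i = A k) (b : m → R) (j : m) :
    cramer A b j = (b i - b k) * adjugate A j i := by
  have cramer_update : cramer A (Function.update b i (b k)) j = 0 := by
    rw [cramer_apply]
    refine det_zero_of_row_eq hik (funext fun l => ?_)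
    simp only [updateCol_apply, hA, Function.update_self, Function.update_of_ne hik.symm]
  have b_eq : b = Function.update b i (b k) + (b i - b k) • Pi.single i 1 := by
    ext l
    obtain rfl | hl := eq_or_ne l i
    · rw [Pi.add_apply, Function.update_self, Pi.smul_apply, Pi.single_eq_same, smul_eq_mul,
        mul_one, add_sub_cancel]
    · rw [Pi.add_apply, Function.update_of_ne hl, Pi.smul_apply, Pi.single_eq_of_ne hl, smul_zero,
        add_zero]
  conv_lhs => rw [b_eq]
  rw [map_add, Pi.add_apply, cramer_update, zero_add, map_smul, Pi.smul_apply,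
    cramer_eq_adjugate_mulVec, mulVec_single_one, col_apply, smul_eq_mul]

variable {K : Type*} [Field K] {n : ℕ}

theorem adjugate_vandermonde_ne_zero {τ : Fin (n + 2) → K}
    (hτ : Function.Injective fun i : Fin (n + 1) => τ i.succ)
    (hτ0 : ∀ i : Fin (n + 1), τ i.succ ≠ 0)
    {j : Fin (n + 2)} (hj : j = 0 ∨ j = Fin.last (n + 1)) :
    adjugate (vandermonde τ) j 0 ≠ 0 := by
  have det_ne_zero := det_vandermonde_ne_zero_iff.mpr hτ
  rw [adjugate_fin_succ_eq_det_submatrix]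
  refine mul_ne_zero (pow_ne_zero _ (neg_ne_zero.mpr one_ne_zero)) ?_
  rcases hj with rfl | rfl
  · have submatrix_eq : (vandermonde τ).submatrix (Fin.succAbove 0) (Fin.succAbove 0) =
        of fun i j => τ i.succ * vandermonde (fun i : Fin (n + 1) => τ i.succ) i j := by
      ext i j
      simp only [submatrix_apply, vandermonde_apply, Fin.zero_succAbove, Fin.val_succ, of_apply,
        pow_succ']
    rw [submatrix_eq, det_mul_column]
    exact mul_ne_zero (prod_ne_zero_iff.mpr fun i _ => hτ0 i) det_ne_zero
  · have submatrix_eq : (vandermonde τ).submatrix (Fin.succAbove 0)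
        (Fin.succAbove (Fin.last (n + 1))) = vandermonde fun i : Fin (n + 1) => τ i.succ := by
      ext i j
      simp only [submatrix_apply, vandermonde_apply, Fin.zero_succAbove, Fin.succAbove_last,
        Fin.val_castSucc]
    rwa [submatrix_eq]

theorem exists_sq_eq_and_smul_sub_ne_zero [IsAlgClosed K] [NeZero (2 : K)] {M : Type*}
    [AddCommGroup M] [Module K M] (Q : QuadraticForm K M) {c : K} {x y : M}
    (h : c * Q x + Q y ≠ 0) : ∃ η : K, η ^ 2 = c ∧ Q (η • x - y) ≠ 0 := by
  obtain ⟨η, rfl⟩ := IsAlgClosed.exists_pow_nat_eq c two_pos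
  have parallelogram : Q (η • x - y) + Q (-η • x - y) = 2 * (η ^ 2 * Q x + Q y) := by
    rw [sub_eq_add_neg, sub_eq_add_neg, QuadraticMap.map_add Q, QuadraticMap.map_add Q]
    simp only [QuadraticMap.map_neg, QuadraticMap.map_smul, QuadraticMap.polar_smul_left,
      smul_eq_mul]
    ring
  by_contra! h0
  rw [h0 η rfl, h0 (-η) (neg_sq η), add_zero] at parallelogram
  exact mul_ne_zero two_ne_zero h parallelogram.symm

theorem exists_injective_isRoot [IsAlgClosed K] {p : K[X]} (hp : p.Separable)
    (hn : p.natDegree = n) : ∃ r : Fin n → K, Function.Injective r ∧ ∀ i, p.IsRoot (r i) := by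
  classical
  have card_roots : p.roots.toFinset.card = n := by
    rw [Multiset.toFinset_card_of_nodup (nodup_roots hp), ← hn]
    exact (IsAlgClosed.splits p).natDegree_eq_card_roots.symm
  let e := (equivFinOfCardEq card_roots).symm
  refine ⟨fun i => e i, Subtype.val_injective.comp e.injective, fun i => ?_⟩
  exact isRoot_of_mem_roots (Multiset.mem_toFinset.mp (e i).2)

theorem exists_eval_polyOfCoeffs_eq {r : Fin n → K} (hr : Function.Injective r) (η : Fin n → K) :
    ∃ y : Fin n → K, ∀ i, (polyOfCoeffs y).eval (r i) = η i := by
  obtain ⟨y, hy⟩ := exists_eq_polyOfCoeffs (n := n) (f := Lagrange.interpolate univ r η) (by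
    simpa only [card_univ, Fintype.card_fin] using
      Lagrange.degree_interpolate_lt (s := univ) η hr.injOn)
  exact ⟨y, fun i => hy ▸ Lagrange.eval_interpolate_at_node η hr.injOn (mem_univ i)⟩

variable {R ι : Type*} [CommRing R] [Algebra R K] [Fintype ι] [DecidableEq ι]

theorem eval_formOver_of_isRoot {A : Type*} [CommRing A] [Algebra R A] {a : Matrix ι ι R} {p : A[X]}
    {v : ι → A[X]} (hv : p ∣ formOver A[X] a v - X) {r : A} (hr : p.IsRoot r) :
    formOver A a (fun l => (v l).eval r) = r := by
  have := hr.dvd hv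
  rwa [IsRoot.def, eval_sub, eval_X, eval_formOver, sub_eq_zero] at this

/-- A repeated value of `T` makes all but one term of Cramer's rule vanish. -/
theorem coordDet_update_mul_det_vandermonde {A : Type*} [CommRing A] {p : A[X]} (hp : p.Monic)
    (hn : p.natDegree = n + 2) {r : Fin (n + 2) → A} (hr : ∀ i, p.IsRoot (r i)) {T : A[X]}
    (hT : T.eval (r 0) = T.eval (r 1)) (f : A[X]) (j : Fin (n + 2)) :
    coordDet (n + 2) p (Function.update (fun i => T ^ (i : ℕ)) j f) * (vandermonde r).det =
      (f.eval (r 0) - f.eval (r 1)) * adjugate (vandermonde fun i => T.eval (r i)) j 0 := by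
  have matrix_eq : (of fun i k => (Function.update (fun i : Fin (n + 2) => T ^ (i : ℕ)) j f
      k).eval (r i)) = (vandermonde fun i => T.eval (r i)).updateCol j fun i => f.eval (r i) := by
    ext i k
    obtain rfl | hk := eq_or_ne k j <;> simp [*, vandermonde_apply]
  rw [coordDet_mul_det_vandermonde p r hp hn hr, matrix_eq, ← cramer_apply,
    cramer_apply_of_row_eq zero_ne_one]
  ext k
  rw [vandermonde_apply, vandermonde_apply, hT]

theorem exists_eval_X_mul_sq_eq_and_smul_sub_ne_zero [IsAlgClosed K] [NeZero (2 : K)] {M : Type*}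
    [AddCommGroup M] [Module K M] (Q : QuadraticForm K M) {r : Fin (n + 2) → K}
    (hr : Function.Injective r) (r_ne_zero : ∀ i, r i ≠ 0) {z : Fin (n + 2) → M}
    (hz : ∀ i, Q (z i) = r i) {τ : Fin (n + 2) → K} (hτ : τ 0 + τ 1 ≠ 0) :
    ∃ y : Fin (n + 2) → K, (∀ i, (X * polyOfCoeffs y ^ 2).eval (r i) = τ i) ∧
      Q ((polyOfCoeffs y).eval (r 0) • z 0 - (polyOfCoeffs y).eval (r 1) • z 1) ≠ 0 := by
  choose sqrt hsqrt using fun i => IsAlgClosed.exists_pow_nat_eq (τ i / r i) two_pos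
  obtain ⟨η₀, hη₀, form_ne_zero⟩ :=
    exists_sq_eq_and_smul_sub_ne_zero Q (c := τ 0 / r 0) (x := z 0) (y := sqrt 1 • z 1) (by
      rwa [QuadraticMap.map_smul, ← sq, hsqrt, hz, hz, smul_eq_mul,
        div_mul_cancel₀ _ (r_ne_zero 0), div_mul_cancel₀ _ (r_ne_zero 1)])
  obtain ⟨y, hy⟩ := exists_eval_polyOfCoeffs_eq hr (Function.update sqrt 0 η₀)
  refine ⟨y, fun i => ?_, ?_⟩
  · rw [eval_mul, eval_pow, eval_X, hy]
    obtain rfl | hi := eq_or_ne i 0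
    · rw [Function.update_self, hη₀, mul_div_cancel₀ _ (r_ne_zero 0)]
    · rw [Function.update_of_ne hi, hsqrt, mul_div_cancel₀ _ (r_ne_zero i)]
  · rwa [hy, hy, Function.update_self, Function.update_of_ne one_ne_zero]

theorem exists_formOver_coordDet_update_ne_zero [IsAlgClosed K] [CharZero K] (a : Matrix ι ι R)
    {p : K[X]} (monic_p : p.Monic) (separable_p : p.Separable) (natDegree_p : p.natDegree = n + 2)
    (hp0 : p.coeff 0 ≠ 0) {v : ι → K[X]} (hv : p ∣ formOver K[X] a v - X)
    {j : Fin (n + 2)} (hj : j = 0 ∨ j = Fin.last (n + 1)) :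
    ∃ y : Fin (n + 2) → K, formOver K a (fun l => coordDet (n + 2) p
      (Function.update (fun i => (X * polyOfCoeffs y ^ 2) ^ (i : ℕ)) j (polyOfCoeffs y * v l)))
        ≠ 0 := by
  obtain ⟨r, hr, root_r⟩ := exists_injective_isRoot separable_p natDegree_p
  have r_ne_zero (i) : r i ≠ 0 := fun h0 => hp0 <| by
    have := (root_r i).eq_zero
    rwa [h0, ← coeff_zero_eq_eval_zero] at this
  -- Equal values at `r 0` and `r 1` reduce the determinant to its terms at these two roots.
  let τ : Fin (n + 2) → K := Fin.cons 1 fun i => (i : ℕ) + 1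
  let z (i) : ι → K := fun l => (v l).eval (r i)
  obtain ⟨y, eval_T, form_ne_zero⟩ :=
    exists_eval_X_mul_sq_eq_and_smul_sub_ne_zero (formOver K a) hr r_ne_zero (z := z)
      (fun i => eval_formOver_of_isRoot hv (root_r i)) (τ := τ) (by norm_num [τ])
  have coordDet_mul (l) := coordDet_update_mul_det_vandermonde monic_p natDegree_p root_r
    (by rw [eval_T, eval_T]; simp [τ]) (polyOfCoeffs y * v l) j
  have coordDet_smul : (vandermonde r).det • (fun l => coordDet (n + 2) p (Function.update
      (fun i => (X * polyOfCoeffs y ^ 2) ^ (i : ℕ)) j (polyOfCoeffs y * v l))) =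
        adjugate (vandermonde τ) j 0 •
          ((polyOfCoeffs y).eval (r 0) • z 0 - (polyOfCoeffs y).eval (r 1) • z 1) := by
    ext l
    rw [Pi.smul_apply, smul_eq_mul, mul_comm, coordDet_mul]
    simp only [eval_T, eval_mul]
    simp [mul_comm, z]
  have adjugate_ne_zero : adjugate (vandermonde τ) j 0 ≠ 0 :=
    adjugate_vandermonde_ne_zero (fun i k hik => by simpa [τ, Fin.val_inj] using hik)
      (fun i => by simpa [τ] using Nat.cast_add_one_ne_zero (i : ℕ)) hj
  refine ⟨y, fun h0 => ?_⟩
  have form_smul := congrArg (formOver K a) coordDet_smul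
  rw [QuadraticMap.map_smul, QuadraticMap.map_smul, h0, smul_zero, eq_comm,
    smul_eq_zero] at form_smul
  exact form_smul.elim (mul_ne_zero adjugate_ne_zero adjugate_ne_zero) form_ne_zero

theorem isGenericallyUnit_formOver_coordDet_update {R : Type u} [CommRing R] [IsLocalRing R]
    [CharZero (IsLocalRing.ResidueField R)] (a : Matrix ι ι R) {p : R[X]} (monic_p : p.Monic)
    (separable_p : p.Separable) {d : ℕ} (natDegree_p : p.natDegree = d) (two_le : 2 ≤ d)
    (hp0 : IsUnit (p.coeff 0)) {v : ι → R[X]} (hv : p ∣ formOver R[X] a v - X) {j : Fin d}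
    (hj : (j : ℕ) = 0 ∨ (j : ℕ) + 1 = d) :
    IsGenericallyUnit fun y : Fin d → R => formOver R a fun l => coordDet d p
      (Function.update (fun i => (X * polyOfCoeffs y ^ 2) ^ (i : ℕ)) j (polyOfCoeffs y * v l)) := by
  obtain ⟨n, rfl⟩ := Nat.exists_eq_add_of_le' two_le
  have j_eq : j = 0 ∨ j = Fin.last (n + 1) :=
    hj.imp (fun h => Fin.ext h) fun h => Fin.ext (Nat.succ_injective h)
  obtain ⟨K, _, _, _, _, _⟩ := exists_isAlgClosed_isLocalHom R
  obtain ⟨y, hy⟩ := exists_formOver_coordDet_update_ne_zero a (monic_p.map (algebraMap R K))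
    (separable_p.map (f := algebraMap R K)) ((monic_p.natDegree_map _).trans natDegree_p)
    (by rw [coeff_map]; exact (hp0.map _).ne_zero)
    (map_dvd_formOver_sub_X a (Algebra.ofId R K) hv) j_eq
  let t (B : Type u) [CommRing B] [Algebra R B] (y : Fin (n + 2) → B) : B :=
    formOver B a fun l => coordDet (n + 2) (p.map (algebraMap R B)) (Function.update
      (fun i => (X * polyOfCoeffs y ^ 2) ^ (i : ℕ)) j
        (polyOfCoeffs y * (v l).map (algebraMap R B)))
  have map_t {B C : Type u} [CommRing B] [CommRing C] [Algebra R B] [Algebra R C] (φ : B →ₐ[R] C)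
      (y : Fin (n + 2) → B) : φ (t B y) = t C (φ ∘ y) := by
    have map_update (g : Fin (n + 2) → B[X]) (f : B[X]) (k : Fin (n + 2)) :
        (Function.update g j f k).map (φ : B →+* C) =
          Function.update (fun k => (g k).map (φ : B →+* C)) j (f.map (φ : B →+* C)) k :=
      Function.apply_update (fun _ => Polynomial.map (φ : B →+* C)) g j f k
    simp only [t, map_formOver, Function.comp_def, map_coordDet φ monic_p, map_update,
      Polynomial.map_pow, Polynomial.map_mul, map_X, map_algHom_map_algebraMap,
      map_polyOfCoeffs, RingHom.coe_coe]
  have isGenericallyUnit_t := isGenericallyUnit_of_natural t map_t hy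
  simpa only [t, Algebra.algebraMap_self, Polynomial.map_id] using isGenericallyUnit_t

end CoefficientTest

section Residual

variable {R ι : Type*} [CommRing R] [Nontrivial R] [Fintype ι] [DecidableEq ι]

theorem exists_residual_factor {a : Matrix ι ι R} {p : R[X]} {u : ι → R[X]} {e : ℕ}
    (hp : p.Monic) (he : 0 < e) (hpu : p ∣ formOver R[X] a u - X)
    (natDegree_u : ∀ l, (u l).natDegree ≤ e)
    (isUnit_top : IsUnit (formOver R a fun l => (u l).coeff e))
    (isUnit_zero : IsUnit (formOver R a fun l => (u l).coeff 0)) :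
    ∃ (c : R) (g : R[X]), formOver R[X] a u - X = p * (C c * g) ∧ g.Monic ∧
      p.natDegree + g.natDegree = e + e ∧ IsUnit (g.coeff 0) ∧
      p.coeff 0 * g.coeff 0 ∈ valueMonoid (formOver R a) := by
  obtain ⟨f, hf⟩ := hpu
  obtain ⟨c, hc⟩ := id isUnit_top
  have coeff_top : (formOver R[X] a u - X).coeff (e + e) = (c : R) := by
    rw [coeff_sub, coeff_formOver a natDegree_u, coeff_X_of_ne_one (by lia), sub_zero, hc]
  have natDegree_sub : (formOver R[X] a u - X).natDegree = e + e := by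
    refine natDegree_eq_of_le_of_coeff_ne_zero ?_ (coeff_top ▸ c.ne_zero)
    exact (natDegree_sub_le _ _).trans
      (max_le (natDegree_formOver_le a natDegree_u) (natDegree_X_le.trans (by lia)))
  have leadingCoeff_f : f.leadingCoeff = (c : R) := by
    rw [← leadingCoeff_monic_mul hp, ← hf, leadingCoeff, natDegree_sub, coeff_top]
  have eval_zero : p.coeff 0 * f.coeff 0 = formOver R a fun l => (u l).coeff 0 := by
    simp only [coeff_zero_eq_eval_zero, ← eval_formOver, ← eval_mul, ← hf, eval_sub, eval_X,
      sub_zero]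
  have f_eq : f = C (c : R) * (C (↑c⁻¹ : R) * f) := by
    rw [← mul_assoc, ← C_mul, c.mul_inv, C_1, one_mul]
  have mul_mem : (c : R) * (p.coeff 0 * (C (↑c⁻¹ : R) * f).coeff 0) ∈
      valueMonoid (formOver R a) := by
    have : (c : R) * (p.coeff 0 * (C (↑c⁻¹ : R) * f).coeff 0) = p.coeff 0 * f.coeff 0 := by
      rw [coeff_C_mul, mul_left_comm, c.mul_inv_cancel_left]
    rw [this, eval_zero]
    exact apply_mem_valueMonoid isUnit_zero
  refine ⟨c, C (↑c⁻¹ : R) * f, f_eq ▸ hf, ?_, ?_, ?_, ?_⟩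
  · rw [Monic, leadingCoeff_C_mul_of_isUnit c⁻¹.isUnit, leadingCoeff_f, c.inv_mul]
  · rw [natDegree_C_mul_of_isUnit c⁻¹.isUnit, ← hp.natDegree_mul', ← hf, natDegree_sub]
    rintro rfl
    exact c.ne_zero (by rw [← leadingCoeff_f, leadingCoeff_zero])
  · rw [coeff_C_mul]
    rw [← eval_zero] at isUnit_zero
    exact c⁻¹.isUnit.mul (isUnit_of_mul_isUnit_right isUnit_zero)
  · exact mem_valueMonoid_of_mul_mem (hc ▸ apply_mem_valueMonoid isUnit_top) mul_mem

end Residual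

section Separable

theorem coeff_zero_dvd_of_mul_self_dvd {A : Type*} [CommRing A] {f g : A[X]} (h : g * g ∣ f) :
    g.coeff 0 ∣ f.coeff 0 ∧ g.coeff 0 ∣ f.coeff 1 := by
  obtain ⟨b, rfl⟩ := h
  simp only [mul_coeff_zero, mul_coeff_one]
  exact ⟨⟨g.coeff 0 * b.coeff 0, by ring⟩,
    ⟨g.coeff 0 * b.coeff 1 + 2 * g.coeff 1 * b.coeff 0, by ring⟩⟩

theorem coeff_zero_swap {A : Type*} [CommRing A] (f : A[X][X]) :
    (Bivariate.swap f).coeff 0 = f.map (evalRingHom 0) := by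
  induction f using Polynomial.induction_on' with
  | add f g hf hg => simp only [map_add, coeff_add, hf, hg, Polynomial.map_add]
  | monomial n f =>
    rw [Bivariate.swap_monomial, mul_coeff_zero, coeff_map, coeff_C_zero, map_monomial,
      coe_evalRingHom, ← coeff_zero_eq_eval_zero, C_mul_X_pow_eq_monomial]

theorem squarefree_map_of_isCoprime_coeff_swap {k : Type*} (K : Type*) [Field k] [Field K]
    [Algebra k[X] K] [IsFractionRing k[X] K] {f : k[X][X]} (hf : f.Monic)
    (h : IsCoprime ((Bivariate.swap f).coeff 0) ((Bivariate.swap f).coeff 1)) :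
    Squarefree (f.map (algebraMap k[X] K)) := by
  intro b hb
  have algebraMap_injective := IsFractionRing.injective k[X] K
  have b_ne_zero : b ≠ 0 := by
    rintro rfl
    exact (hf.map (algebraMap k[X] K)).ne_zero (zero_dvd_iff.mp (by rwa [mul_zero] at hb))
  have isUnit_C_leadingCoeff := isUnit_C.mpr (leadingCoeff_ne_zero.mpr b_ne_zero).isUnit
  obtain ⟨g, hg⟩ := IsIntegrallyClosed.eq_map_mul_C_of_dvd K hf (dvd_of_mul_right_dvd hb)
  have monic_g : g.Monic := by
    refine monic_of_injective algebraMap_injective ?_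
    have := congrArg leadingCoeff hg
    rw [leadingCoeff_mul, leadingCoeff_C] at this
    exact mul_right_cancel₀ (leadingCoeff_ne_zero.mpr b_ne_zero) (by rw [this, one_mul])
  have mul_self_dvd : g * g ∣ f := by
    rw [← Polynomial.map_dvd_map _ algebraMap_injective (monic_g.mul monic_g), Polynomial.map_mul]
    have map_dvd_b : g.map (algebraMap k[X] K) ∣ b := ⟨_, hg.symm⟩
    exact (mul_dvd_mul map_dvd_b map_dvd_b).trans hb
  obtain ⟨dvd_coeff_zero, dvd_coeff_one⟩ := coeff_zero_dvd_of_mul_self_dvd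
    (by simpa only [map_mul] using map_dvd Bivariate.swap mul_self_dvd)
  have isUnit_g := h.isUnit_of_dvd' dvd_coeff_zero dvd_coeff_one
  rw [coeff_zero_swap, (monic_g.map _).isUnit_iff] at isUnit_g
  have g_eq_one : g = 1 := by
    refine eq_one_of_monic_natDegree_zero monic_g ?_
    rw [← monic_g.natDegree_map (evalRingHom 0), isUnit_g, natDegree_one]
  rwa [← hg, g_eq_one, Polynomial.map_one, one_mul]

theorem map_resultant_derivative_ne_zero_iff {A K : Type*} [CommRing A] [Field K] [CharZero K]
    (φ : A →+* K) {f : A[X]} {n : ℕ} (hf : f.map φ ≠ 0) (hn : (f.map φ).natDegree = n) :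
    φ (resultant f (derivative f) n (n - 1)) ≠ 0 ↔ (f.map φ).Separable := by
  have natDegree_derivative_map : (f.derivative.map φ).natDegree = n - 1 := by
    rw [← derivative_map, natDegree_derivative, hn]
  have := resultant_eq_zero_iff (f := f.map φ) (g := f.derivative.map φ)
  rw [hn, natDegree_derivative_map, resultant_map_map] at this
  rw [ne_eq, this, Separable, derivative_map, not_and, not_not]
  exact forall_prop_of_true (Or.inl hf)

theorem exists_separable_pencil {k : Type*} [Field k] [CharZero k] {p g h : k[X]} (hp : p.Monic)
    (hg : g.natDegree < p.natDegree) (hh : h.natDegree < p.natDegree) (hpg : IsCoprime p g) :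
    ∃ μ ≠ 0, (p + C μ * g + C (μ ^ 2) * h).Separable := by
  let f : k[X][X] := p.map C + (C X * g.map C + C (X ^ 2) * h.map C)
  have natDegree_lt : (C X * g.map C + C (X ^ 2) * h.map C).natDegree < (p.map C).natDegree := by
    rw [hp.natDegree_map]
    exact (natDegree_add_le _ _).trans_lt (max_lt
      ((natDegree_C_mul_le _ _).trans_lt (natDegree_map_le.trans_lt hg))
      ((natDegree_C_mul_le _ _).trans_lt (natDegree_map_le.trans_lt hh)))
  have monic_f : f.Monic := (hp.map C).add_of_left (degree_lt_degree natDegree_lt)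
  have swap_f : Bivariate.swap f = C p + X * C g + X ^ 2 * C h := by
    simp only [f, map_add, map_mul, Bivariate.swap_map_C, Bivariate.swap_X, map_pow, add_assoc]
  have resultant_ne_zero : resultant f f.derivative f.natDegree (f.natDegree - 1) ≠ 0 := by
    refine ne_of_apply_ne (algebraMap k[X] (RatFunc k)) ?_
    rw [map_zero, map_resultant_derivative_ne_zero_iff _ (monic_f.map _).ne_zero
      (monic_f.natDegree_map _), PerfectField.separable_iff_squarefree]
    refine squarefree_map_of_isCoprime_coeff_swap _ monic_f ?_
    simpa [swap_f, coeff_X_pow, pow_two, mul_assoc] using hpg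
  obtain ⟨μ, hμ⟩ : ∃ μ, (X * resultant f f.derivative f.natDegree (f.natDegree - 1)).eval μ ≠
      0 := by
    by_contra! h0
    exact mul_ne_zero X_ne_zero resultant_ne_zero
      (Polynomial.funext fun μ => (h0 μ).trans eval_zero.symm)
  rw [eval_mul, eval_X, mul_ne_zero_iff, ← coe_evalRingHom, map_resultant_derivative_ne_zero_iff _
    (monic_f.map _).ne_zero (monic_f.natDegree_map _)] at hμ
  have eval_comp_C : (evalRingHom μ).comp C = RingHom.id k := RingHom.ext fun _ => eval_C
  refine ⟨μ, hμ.1, ?_⟩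
  simpa [f, Polynomial.map_map, eval_comp_C, add_assoc] using hμ.2

end Separable

section Direction

theorem eval_polar_formOver {R A ι : Type*} [CommRing R] [CommRing A] [Algebra R A] [Fintype ι]
    [DecidableEq ι] (a : Matrix ι ι R) (v : ι → A[X]) (w : ι → A) (r : A) :
    (QuadraticMap.polar (formOver A[X] a) v (C ∘ w)).eval r =
      QuadraticMap.polar (formOver A a) (fun l => (v l).eval r) w := by
  have := map_polar_formOver a ((aeval r).restrictScalars R) v (C ∘ w)
  simpa [Function.comp_def, coe_aeval_eq_eval] using this

variable {K R ι : Type*} [Field K] [CommRing R] [Algebra R K] [Fintype ι] [DecidableEq ι]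

theorem exists_formOver_ne_zero_forall_polar_ne_zero [Infinite K] [NeZero (2 : K)]
    (a : Matrix ι ι R) {s : Finset (ι → K)} (hs : s.Nonempty)
    (h : ∀ z ∈ s, formOver K a z ≠ 0) :
    ∃ w, formOver K a w ≠ 0 ∧ ∀ z ∈ s, QuadraticMap.polar (formOver K a) z w ≠ 0 := by
  let specialize (w : ι → K) : MvPolynomial ι K →ₐ[R] K := (MvPolynomial.aeval w).restrictScalars R
  have specialize_X (w) : specialize w ∘ MvPolynomial.X = w :=
    funext fun i => MvPolynomial.aeval_X w i
  have specialize_C (w z : ι → K) : specialize w ∘ MvPolynomial.C ∘ z = z :=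
    funext fun i => MvPolynomial.aeval_C w (z i)
  let F : MvPolynomial ι K := formOver _ a MvPolynomial.X
  let G (z : ι → K) : MvPolynomial ι K :=
    QuadraticMap.polar (formOver _ a) (MvPolynomial.C ∘ z) MvPolynomial.X
  have specialize_F (w) : specialize w F = formOver K a w := by
    rw [map_formOver, specialize_X]
  have specialize_G (w z) : specialize w (G z) = QuadraticMap.polar (formOver K a) z w := by
    rw [map_polar_formOver, specialize_X, specialize_C]
  obtain ⟨z₀, hz₀⟩ := hs
  have F_ne_zero : F ≠ 0 := fun h0 => h z₀ hz₀ (by rw [← specialize_F, h0, map_zero])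
  have G_ne_zero (z) (hz : z ∈ s) : G z ≠ 0 := fun h0 => by
    have polar_self := specialize_G z z
    rw [h0, map_zero, QuadraticMap.polar_self, nsmul_eq_mul, Nat.cast_ofNat] at polar_self
    exact mul_ne_zero two_ne_zero (h z hz) polar_self.symm
  obtain ⟨w, hw⟩ : ∃ w, specialize w (F * ∏ z ∈ s, G z) ≠ 0 := by
    by_contra! h0
    exact mul_ne_zero F_ne_zero (prod_ne_zero_iff.mpr G_ne_zero)
      (MvPolynomial.funext fun w => (h0 w).trans (map_zero _).symm)
  rw [map_mul, map_prod, mul_ne_zero_iff, prod_ne_zero_iff, specialize_F] at hw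
  exact ⟨w, hw.1, fun z hz => specialize_G w z ▸ hw.2 z hz⟩

theorem exists_formOver_eq_one_isCoprime_polar [IsAlgClosed K] [CharZero K] (a : Matrix ι ι R)
    {p : K[X]} {v : ι → K[X]} (natDegree_p : p.natDegree ≠ 0) (hp0 : p.coeff 0 ≠ 0)
    (hv : p ∣ formOver K[X] a v - X) :
    ∃ w, formOver K a w = 1 ∧ IsCoprime p (QuadraticMap.polar (formOver K[X] a) v (C ∘ w)) := by
  classical
  have p_ne_zero : p ≠ 0 := ne_zero_of_natDegree_gt (Nat.pos_of_ne_zero natDegree_p)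
  let z (r : K) : ι → K := fun l => (v l).eval r
  have form_z_ne_zero (r) (hr : p.IsRoot r) : formOver K a (z r) ≠ 0 := by
    rw [eval_formOver_of_isRoot hv hr]
    rintro rfl
    exact hp0 ((coeff_zero_eq_eval_zero p).trans hr)
  obtain ⟨r₀, hr₀⟩ := IsAlgClosed.exists_root p (degree_ne_of_natDegree_ne natDegree_p)
  obtain ⟨w, form_w_ne_zero, polar_ne_zero⟩ :=
    exists_formOver_ne_zero_forall_polar_ne_zero a (s := p.roots.toFinset.image z)
      ⟨z r₀, mem_image_of_mem z (Multiset.mem_toFinset.mpr ((mem_roots p_ne_zero).mpr hr₀))⟩ (by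
        simpa [p_ne_zero] using form_z_ne_zero)
  obtain ⟨η, hη⟩ := IsAlgClosed.exists_pow_nat_eq (formOver K a w)⁻¹ two_pos
  refine ⟨η • w, ?_, ?_⟩
  · rw [QuadraticMap.map_smul, ← sq, hη, smul_eq_mul, inv_mul_cancel₀ form_w_ne_zero]
  · rw [isCoprime_iff_aeval_ne_zero_of_isAlgClosed K K]
    intro r
    simp only [coe_aeval_eq_eval, or_iff_not_imp_left, not_not, eval_polar_formOver,
      QuadraticMap.polar_smul_right]
    intro hr
    have η_ne_zero : η ≠ 0 := by
      rintro rfl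
      exact inv_ne_zero form_w_ne_zero (by rw [← hη, zero_pow two_ne_zero])
    exact smul_ne_zero η_ne_zero (polar_ne_zero _ (mem_image_of_mem z
      (Multiset.mem_toFinset.mpr ((mem_roots p_ne_zero).mpr hr))))

end Direction

section DeformedCofactor

variable {R A B ι : Type*} [CommRing R] [CommRing A] [CommRing B] [Algebra R A] [Algebra R B]
  [Fintype ι] [DecidableEq ι] (a : Matrix ι ι R)

/-- If `p * h = Q(v) - X`, this is the cofactor of `p` in `Q(v + p w) - X`, where `w` is a constant
vector; see `mul_deformedCofactor`. -/
noncomputable def deformedCofactor (p h : A[X]) (v : ι → A[X]) (w : ι → A) : A[X] :=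
  h + QuadraticMap.polar (formOver A[X] a) v (C ∘ w) + p * C (formOver A a w)

theorem formOver_C_comp (w : ι → A) : formOver A[X] a (C ∘ w) = C (formOver A a w) :=
  (map_formOver a ((CAlgHom : A →ₐ[A] A[X]).restrictScalars R) w).symm

theorem mul_deformedCofactor {p h : A[X]} {v : ι → A[X]} (hv : formOver A[X] a v - X = p * h)
    (w : ι → A) :
    p * deformedCofactor a p h v w = formOver A[X] a (fun l => v l + p * C (w l)) - X := by
  have add_eq : (fun l => v l + p * C (w l)) = v + p • (C ∘ w) := rfl
  rw [deformedCofactor, add_eq, QuadraticMap.map_add (formOver A[X] a), QuadraticMap.map_smul,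
    QuadraticMap.polar_smul_right, formOver_C_comp, smul_eq_mul, smul_eq_mul]
  linear_combination -hv

theorem map_deformedCofactor (φ : A →ₐ[R] B) (p h : A[X]) (v : ι → A[X]) (w : ι → A) :
    (deformedCofactor a p h v w).map (φ : A →+* B) =
      deformedCofactor a (p.map (φ : A →+* B)) (h.map (φ : A →+* B))
        (fun l => (v l).map (φ : A →+* B)) (φ ∘ w) := by
  have map_polar := map_polar_formOver a (mapAlgHom φ) v (C ∘ w)
  have map_C_comp : mapAlgHom φ ∘ C ∘ w = C ∘ φ ∘ w := funext fun l => map_C (φ : A →+* B)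
  rw [map_C_comp, coe_mapAlgHom] at map_polar
  simp only [deformedCofactor, Polynomial.map_add, Polynomial.map_mul, map_polar, map_C,
    RingHom.coe_coe, map_formOver]
  rfl

theorem natDegree_polar_formOver_C_le {v : ι → A[X]} {d : ℕ} (hv : ∀ l, (v l).natDegree ≤ d)
    (w : ι → A) : (QuadraticMap.polar (formOver A[X] a) v (C ∘ w)).natDegree ≤ d := by
  have natDegree_term (i j) : (v i * algebraMap R A[X] (a i j) * C (w j)).natDegree ≤ d := by
    rw [Polynomial.algebraMap_apply]
    exact (natDegree_mul_C_le _ _).trans ((natDegree_mul_C_le _ _).trans (hv i))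
  have natDegree_term' (i j) : (C (w i) * algebraMap R A[X] (a i j) * v j).natDegree ≤ d := by
    rw [Polynomial.algebraMap_apply, ← C_mul]
    exact (natDegree_C_mul_le _ _).trans (hv j)
  simp only [formOver, LinearMap.BilinMap.polar_toQuadraticMap, toBilin'_apply, map_apply,
    Function.comp_apply]
  refine natDegree_add_le_of_degree_le ?_ ?_ <;>
    refine natDegree_sum_le_of_forall_le _ _ fun i _ =>
      natDegree_sum_le_of_forall_le _ _ fun j _ => ?_
  exacts [natDegree_term i j, natDegree_term' i j]

end DeformedCofactor

section SeparableReplacement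

variable {A ι : Type*} [CommRing A] [Fintype ι] [DecidableEq ι]

theorem natDegree_cofactor_lt {R : Type*} [CommRing R] [Nontrivial A] [Algebra R A]
    {a : Matrix ι ι R} {p h : A[X]} {v : ι → A[X]} (hp : p.Monic)
    (natDegree_v : ∀ l, (v l).natDegree < p.natDegree) (natDegree_p : p.natDegree ≠ 0)
    (hv : formOver A[X] a v - X = p * h) : h.natDegree < p.natDegree := by
  have natDegree_sub : (formOver A[X] a v - X).natDegree < p.natDegree + p.natDegree :=
    (natDegree_sub_le _ _).trans_lt (max_lt
      ((natDegree_formOver_le a fun l => Nat.le_sub_one_of_lt (natDegree_v l)).trans_lt (by lia))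
      (natDegree_X_le.trans_lt (by lia)))
  obtain rfl | h_ne_zero := eq_or_ne h 0
  · rw [natDegree_zero]
    lia
  · rw [hv, hp.natDegree_mul' h_ne_zero] at natDegree_sub
    lia

theorem natDegree_deformedCofactor {R : Type*} [CommRing R] [Algebra R A] (a : Matrix ι ι R)
    {p h : A[X]} {v : ι → A[X]} {w : ι → A} (hp : p.Monic)
    (natDegree_v : ∀ l, (v l).natDegree < p.natDegree) (natDegree_h : h.natDegree < p.natDegree)
    (hw : formOver A a w ≠ 0) : (deformedCofactor a p h v w).natDegree = p.natDegree := by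
  have natDegree_mul_C : (p * C (formOver A a w)).natDegree = p.natDegree :=
    natDegree_mul_C_eq_of_mul_ne_zero (by rwa [hp.leadingCoeff, one_mul])
  have natDegree_polar := natDegree_polar_formOver_C_le a
    (fun l => Nat.le_sub_one_of_lt (natDegree_v l)) w
  rw [deformedCofactor, natDegree_add_eq_right_of_natDegree_lt, natDegree_mul_C]
  rw [natDegree_mul_C]
  exact (natDegree_add_le _ _).trans_lt (max_lt natDegree_h (by lia))

theorem exists_separable_deformedCofactor {K R : Type*} [Field K] [IsAlgClosed K] [CharZero K]
    [CommRing R] [Algebra R K] (a : Matrix ι ι R) {p h : K[X]} {v : ι → K[X]} (hp : p.Monic)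
    (hp0 : p.coeff 0 ≠ 0) (natDegree_v : ∀ l, (v l).natDegree < p.natDegree)
    (natDegree_p : p.natDegree ≠ 0) (hv : formOver K[X] a v - X = p * h) :
    ∃ w, formOver K a w ≠ 0 ∧ (deformedCofactor a p h v w).Separable := by
  obtain ⟨w, form_w, isCoprime_polar⟩ :=
    exists_formOver_eq_one_isCoprime_polar a natDegree_p hp0 (Dvd.intro _ hv.symm)
  have natDegree_polar := natDegree_polar_formOver_C_le a
    (fun l => Nat.le_sub_one_of_lt (natDegree_v l)) w
  obtain ⟨μ, μ_ne_zero, separable_pencil⟩ := exists_separable_pencil hp (by lia)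
    (natDegree_cofactor_lt hp natDegree_v natDegree_p hv) isCoprime_polar
  have form_smul : formOver K a (μ⁻¹ • w) = μ⁻¹ ^ 2 := by
    rw [QuadraticMap.map_smul, form_w, smul_eq_mul, mul_one, sq]
  refine ⟨μ⁻¹ • w, form_smul ▸ pow_ne_zero 2 (inv_ne_zero μ_ne_zero), ?_⟩
  have C_comp_smul : C ∘ (μ⁻¹ • w) = C μ⁻¹ • (C ∘ w) := funext fun i => C_mul
  have C_mul_C_inv : C μ * C μ⁻¹ = 1 := by rw [← C_mul, mul_inv_cancel₀ μ_ne_zero, C_1]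
  have deformedCofactor_eq : deformedCofactor a p h v (μ⁻¹ • w) = C (μ⁻¹ ^ 2) *
      (p + C μ * QuadraticMap.polar (formOver K[X] a) v (C ∘ w) + C (μ ^ 2) * h) := by
    rw [deformedCofactor, form_smul, C_comp_smul, QuadraticMap.polar_smul_right, smul_eq_mul,
      C_pow, C_pow]
    linear_combination (-C μ⁻¹ * QuadraticMap.polar (formOver K[X] a) v (C ∘ w) -
      (C μ * C μ⁻¹ + 1) * h) * C_mul_C_inv
  rw [deformedCofactor_eq]
  exact separable_pencil.unit_mul
    (isUnit_C.mpr (isUnit_iff_ne_zero.mpr (pow_ne_zero 2 (inv_ne_zero μ_ne_zero))))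

/-- The discriminant, up to a factor, of `deformedCofactor a p h v w` regarded as a polynomial of
formal degree `n`. -/
noncomputable def resultantDeformedCofactor {R : Type*} [CommRing R] [Algebra R A]
    (a : Matrix ι ι R) (p h : A[X]) (v : ι → A[X]) (n : ℕ) (w : ι → A) : A :=
  resultant (deformedCofactor a p h v w) (deformedCofactor a p h v w).derivative n (n - 1)

theorem map_resultantDeformedCofactor {R B : Type*} [CommRing R] [CommRing B] [Algebra R A]
    [Algebra R B] (a : Matrix ι ι R) (φ : A →ₐ[R] B) (p h : A[X]) (v : ι → A[X]) (n : ℕ)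
    (w : ι → A) :
    φ (resultantDeformedCofactor a p h v n w) =
      resultantDeformedCofactor a (p.map (φ : A →+* B)) (h.map (φ : A →+* B))
        (fun l => (v l).map (φ : A →+* B)) n (φ ∘ w) := by
  refine (resultant_map_map _ _ _ _ (φ : A →+* B)).symm.trans ?_
  rw [← derivative_map, map_deformedCofactor, resultantDeformedCofactor]

theorem exists_resultant_deformedCofactor_ne_zero {K R : Type*} [Field K] [IsAlgClosed K]
    [CharZero K] [CommRing R] [Algebra R K] (a : Matrix ι ι R) {p h : K[X]} {v : ι → K[X]} {n : ℕ}
    (hp : p.Monic) (hp0 : p.coeff 0 ≠ 0) (natDegree_p : p.natDegree = n) (n_ne_zero : n ≠ 0)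
    (natDegree_v : ∀ l, (v l).natDegree < n) (hv : formOver K[X] a v - X = p * h) :
    ∃ w, resultantDeformedCofactor a p h v n w ≠ 0 := by
  subst natDegree_p
  obtain ⟨w, form_w, separable_w⟩ :=
    exists_separable_deformedCofactor a hp hp0 natDegree_v n_ne_zero hv
  have natDegree_eq := natDegree_deformedCofactor a hp natDegree_v
    (natDegree_cofactor_lt hp natDegree_v n_ne_zero hv) form_w
  rw [← Polynomial.map_id (p := deformedCofactor a p h v w)] at natDegree_eq separable_w
  exact ⟨w,
    (map_resultant_derivative_ne_zero_iff _ separable_w.ne_zero natDegree_eq).mpr separable_w⟩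

theorem separable_of_isUnit_resultant {f : A[X]} {n : ℕ} (hn : f.natDegree = n) (n_ne_zero : n ≠ 0)
    (h : IsUnit (resultant f f.derivative n (n - 1))) : f.Separable := by
  obtain ⟨b, c, -, -, hbc⟩ := exists_mul_add_mul_eq_C_resultant f f.derivative hn.le
    ((natDegree_derivative_le f).trans_eq (by rw [hn])) (Or.inl n_ne_zero)
  obtain ⟨d, hd⟩ := (isUnit_C.mpr h).exists_left_inv
  exact ⟨d * b, d * c, by linear_combination d * hbc + hd⟩

variable {R : Type u} {ι : Type} [CommRing R] [IsLocalRing R] [Fintype ι] [DecidableEq ι]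
  [CharZero (IsLocalRing.ResidueField R)] (a : Matrix ι ι R)

theorem IsGenericallyUnit.comp_add_smul {σ : Type} {f : (σ → R) → R} (hf : IsGenericallyUnit f)
    (x : σ → R) {c : R} (hc : IsUnit c) : IsGenericallyUnit fun y => f (x + c • y) := by
  obtain ⟨y₀, hy₀⟩ := hf.exists_isUnit
  obtain ⟨F, hF, -⟩ := hf
  obtain ⟨d, hcd⟩ := hc.exists_right_inv
  let G := MvPolynomial.bind₁
    (fun i => MvPolynomial.C (x i) + MvPolynomial.C c * MvPolynomial.X i) F
  have eval_G (y) : MvPolynomial.eval y G = f (x + c • y) := by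
    rw [← hF, ← MvPolynomial.coe_aeval_eq_eval, RingHom.coe_coe, MvPolynomial.aeval_bind₁]
    simp [Pi.add_def, Pi.smul_def]
  have affine_eq : x + c • d • (y₀ - x) = y₀ := by
    rw [smul_smul, hcd, one_smul, add_sub_cancel]
  refine ⟨G, eval_G, fun h0 => ?_⟩
  rw [← affine_eq, ← eval_G, ← IsLocalRing.residue_ne_zero_iff_isUnit, MvPolynomial.map_eval, h0,
    map_zero] at hy₀
  exact hy₀ rfl

theorem isGenericallyUnit_formOver {p : R[X]} {v : ι → R[X]} (hp : p.Monic)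
    (natDegree_p : p.natDegree ≠ 0) (hp0 : IsUnit (p.coeff 0)) (hv : p ∣ formOver R[X] a v - X) :
    IsGenericallyUnit (formOver R a) := by
  obtain ⟨K, _, _, _, _, _⟩ := exists_isAlgClosed_isLocalHom R
  obtain ⟨r, hr⟩ := IsAlgClosed.exists_root (p.map (algebraMap R K))
    (degree_ne_of_natDegree_ne (by rwa [hp.natDegree_map]))
  have form_eq := eval_formOver_of_isRoot (map_dvd_formOver_sub_X a (Algebra.ofId R K) hv) hr
  have r_ne_zero : r ≠ 0 := by
    rintro rfl
    rw [IsRoot.def, ← coeff_zero_eq_eval_zero, coeff_map] at hr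
    exact (hp0.map _).ne_zero hr
  let t (B : Type u) [CommRing B] [Algebra R B] (y : ι → B) : B := formOver B a y
  exact isGenericallyUnit_of_natural t (fun φ y => map_formOver a φ y) (form_eq.trans_ne r_ne_zero)

theorem isGenericallyUnit_resultant_deformedCofactor {p h : R[X]} {v : ι → R[X]} {n : ℕ}
    (hp : p.Monic) (hp0 : IsUnit (p.coeff 0)) (natDegree_p : p.natDegree = n) (n_ne_zero : n ≠ 0)
    (natDegree_v : ∀ l, (v l).natDegree < n) (hv : formOver R[X] a v - X = p * h) :
    IsGenericallyUnit (resultantDeformedCofactor a p h v n) := by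
  obtain ⟨K, _, _, _, _, _⟩ := exists_isAlgClosed_isLocalHom R
  have map_hv : formOver K[X] a (fun l => (v l).map (algebraMap R K)) - X =
      p.map (algebraMap R K) * h.map (algebraMap R K) := by
    have := congrArg (mapAlgHom (Algebra.ofId R K)) hv
    rwa [map_sub, map_formOver, map_mul, coe_mapAlgHom, map_X] at this
  obtain ⟨w, hw⟩ := exists_resultant_deformedCofactor_ne_zero a (hp.map (algebraMap R K))
    (by rw [coeff_map]; exact (hp0.map _).ne_zero) ((hp.natDegree_map _).trans natDegree_p)
    n_ne_zero (fun l => natDegree_map_le.trans_lt (natDegree_v l)) map_hv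
  let t (B : Type u) [CommRing B] [Algebra R B] (w : ι → B) : B :=
    resultantDeformedCofactor a (p.map (algebraMap R B)) (h.map (algebraMap R B))
      (fun l => (v l).map (algebraMap R B)) n w
  have map_t {B C : Type u} [CommRing B] [CommRing C] [Algebra R B] [Algebra R C] (φ : B →ₐ[R] C)
      (w : ι → B) : φ (t B w) = t C (φ ∘ w) := by
    simp only [t, map_resultantDeformedCofactor, map_algHom_map_algebraMap]
  have isGenericallyUnit_t := isGenericallyUnit_of_natural t map_t hw
  simpa only [t, Algebra.algebraMap_self, Polynomial.map_id] using isGenericallyUnit_t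

theorem exists_separable_replacement {p : R[X]} {v : ι → R[X]} (hp : p.Monic)
    (natDegree_p : p.natDegree ≠ 0) (hp0 : IsUnit (p.coeff 0))
    (natDegree_v : ∀ l, (v l).natDegree < p.natDegree) (hv : p ∣ formOver R[X] a v - X) :
    ∃ (g : R[X]) (u : ι → R[X]), g.Monic ∧ g.natDegree = p.natDegree ∧ g.Separable ∧
      IsUnit (g.coeff 0) ∧ g ∣ formOver R[X] a u - X ∧
      p.coeff 0 * g.coeff 0 ∈ valueMonoid (formOver R a) := by
  obtain ⟨h, hv⟩ := hv
  have generic_unit := isGenericallyUnit_formOver a hp natDegree_p hp0 (Dvd.intro _ hv.symm)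
  obtain ⟨w, hw⟩ := ((generic_unit.mul (generic_unit.comp_add_smul (fun l => (v l).coeff 0)
    hp0)).mul (isGenericallyUnit_resultant_deformedCofactor a hp hp0 rfl natDegree_p natDegree_v
      hv)).exists_isUnit
  obtain ⟨⟨isUnit_top, isUnit_zero⟩, isUnit_resultant⟩ := hw
    |> IsUnit.mul_iff.mp |>.imp_left IsUnit.mul_iff.mp
  have separable_deformedCofactor := separable_of_isUnit_resultant
    (natDegree_deformedCofactor a hp natDegree_v
      (natDegree_cofactor_lt hp natDegree_v natDegree_p hv) isUnit_top.ne_zero)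
    natDegree_p isUnit_resultant
  let u l := v l + p * C (w l)
  have natDegree_u (l) : (u l).natDegree ≤ p.natDegree :=
    natDegree_add_le_of_degree_le (natDegree_v l).le (natDegree_mul_C_le _ _)
  have coeff_u : (fun l => (u l).coeff p.natDegree) = w := funext fun l => by
    rw [coeff_add, coeff_eq_zero_of_natDegree_lt (natDegree_v l), coeff_mul_C, hp.coeff_natDegree,
      one_mul, zero_add]
  have coeff_zero_u : (fun l => (u l).coeff 0) =
      (fun l => (v l).coeff 0) + p.coeff 0 • w := funext fun l => by
    rw [coeff_add, coeff_mul_C, Pi.add_apply, Pi.smul_apply, smul_eq_mul]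
  obtain ⟨c, g, form_u, monic_g, natDegree_g, hg0, mem⟩ := exists_residual_factor hp
    (Nat.pos_of_ne_zero natDegree_p) (mul_deformedCofactor a hv w ▸ dvd_mul_right _ _)
    natDegree_u (coeff_u ▸ isUnit_top) (coeff_zero_u ▸ isUnit_zero)
  refine ⟨g, u, monic_g, by lia, ?_, hg0, form_u ▸ ⟨p * C c, by ring⟩, mem⟩
  have deformedCofactor_eq : deformedCofactor a p h v w = C c * g :=
    hp.isRegular.left ((mul_deformedCofactor a hv w).trans form_u)
  exact (deformedCofactor_eq ▸ separable_deformedCofactor).of_mul_right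

end SeparableReplacement

section Induction

theorem isCoprime_X_left {A : Type*} [CommRing A] {p : A[X]} (hp0 : IsUnit (p.coeff 0)) :
    IsCoprime X p := by
  obtain ⟨c, hc⟩ := hp0.exists_left_inv
  have C_mul_C : C c * C (p.coeff 0) = 1 := by rw [← C_mul, hc, C_1]
  exact ⟨-C c * p.divX, C c, by linear_combination C_mul_C - C c * p.divX_mul_X_add⟩

theorem exists_change_root_X_mul_sq {R ι : Type*} [CommRing R] [Nontrivial R] [Fintype ι]
    [DecidableEq ι] (a : Matrix ι ι R) {p : R[X]} {v : ι → R[X]} {Y : R[X]} (hp : p.Monic)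
    (hv : p ∣ formOver R[X] a v - X)
    (hY : IsUnit (coordDet p.natDegree p fun j => (X * Y ^ 2) ^ (j : ℕ))) :
    ∃ (P : R[X]) (u : ι → R[X]), P.Monic ∧ P.natDegree = p.natDegree ∧
      P ∣ formOver R[X] a u - X ∧
      P.coeff 0 = p.coeff 0 * coordDet p.natDegree p (fun j => Y * X ^ (j : ℕ)) ^ 2 ∧
      (∀ l, (u l).natDegree ≤ p.natDegree - 1) ∧
      ∀ j : Fin p.natDegree, coordDet p.natDegree p (fun i => (X * Y ^ 2) ^ (i : ℕ)) ^ 2 *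
          formOver R a (fun l => (u l).coeff j) =
        formOver R a fun l => coordDet p.natDegree p
          (Function.update (fun i => (X * Y ^ 2) ^ (i : ℕ)) j (Y * v l)) := by
  let h := AdjoinRoot.isAdjoinRootMonic p hp
  have form_eq : formOver (AdjoinRoot p) a (fun l => h.map (Y * v l)) = h.map (X * Y ^ 2) := by
    have map_form := h.map_eq_zero_iff.mpr hv
    rw [map_sub, sub_eq_zero] at map_form
    rw [map_mul, ← map_form, map_pow, map_formOver, mul_comm, sq, ← smul_eq_mul,
      ← QuadraticMap.map_smul]
    exact congrArg _ (funext fun l => map_mul h.map Y (v l))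
  have det_eq : h.basis.det (fun j => formOver (AdjoinRoot p) a
      (fun l => h.map (Y * v l)) ^ (j : ℕ)) =
        coordDet p.natDegree p fun j => (X * Y ^ 2) ^ (j : ℕ) := by
    simp only [form_eq, ← map_pow, basis_det_map]
  have norm_eq : Algebra.norm R (h.map Y) = coordDet p.natDegree p fun j => Y * X ^ (j : ℕ) := by
    rw [← basis_det_mul_eq_norm h]
    simp only [h.basis_apply, ← h.map_X, ← map_pow, ← map_mul, basis_det_map]
  obtain ⟨P, u, monic_P, natDegree_P, hu, norm_form, degree_u, cramer⟩ :=
    exists_change_root h a (s := fun l => h.map (Y * v l)) (det_eq ▸ hY)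
  refine ⟨P, u, monic_P, natDegree_P, hu, ?_, fun l => ?_, fun j => ?_⟩
  · rw [form_eq, map_mul, map_mul, map_pow, map_pow, h.map_X, norm_root, norm_eq, mul_assoc]
      at norm_form
    exact (isUnit_neg_one.pow _).mul_left_cancel norm_form
  · refine natDegree_le_iff_coeff_eq_zero.mpr fun i hi => coeff_eq_zero_of_degree_lt
      ((degree_u l).trans_le (Nat.cast_le.mpr (Nat.le_of_pred_lt hi)))
  · rw [← det_eq, cramer]
    simp only [form_eq, ← map_pow, basis_det_update_map]

variable {R : Type u} [CommRing R] [IsLocalRing R] [CharZero (IsLocalRing.ResidueField R)]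
  {ι : Type} [Fintype ι] [DecidableEq ι] (a : Matrix ι ι R)

theorem exists_isUnit_formOver_coeff {p : R[X]} {v : ι → R[X]} (hp : p.Monic)
    (two_le : 2 ≤ p.natDegree) (separable_p : p.Separable) (hp0 : IsUnit (p.coeff 0))
    (hv : p ∣ formOver R[X] a v - X) :
    ∃ (P : R[X]) (u : ι → R[X]) (r : R), P.Monic ∧ P.natDegree = p.natDegree ∧ IsUnit r ∧
      P.coeff 0 = p.coeff 0 * r ^ 2 ∧ P ∣ formOver R[X] a u - X ∧
      (∀ l, (u l).natDegree ≤ p.natDegree - 1) ∧ IsUnit (formOver R a fun l => (u l).coeff 0) ∧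
      IsUnit (formOver R a fun l => (u l).coeff (p.natDegree - 1)) := by
  let first : Fin p.natDegree := ⟨0, by lia⟩
  let last : Fin p.natDegree := ⟨p.natDegree - 1, by lia⟩
  have last_add_one : (last : ℕ) + 1 = p.natDegree := Nat.sub_add_cancel (by lia)
  have generic_coeff {j : Fin p.natDegree} (hj) :=
    isGenericallyUnit_formOver_coordDet_update a hp separable_p rfl two_le hp0 hv (j := j) hj
  obtain ⟨y, hy⟩ := ((isGenericallyUnit_coordDet_mul_pow hp rfl).mul
    (isGenericallyUnit_coordDet_mul_sq_pow hp rfl (isCoprime_X_left hp0))).mul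
    ((generic_coeff (Or.inl (rfl : (first : ℕ) = 0))).mul
      (generic_coeff (Or.inr last_add_one))) |>.exists_isUnit
  simp only [IsUnit.mul_iff] at hy
  obtain ⟨⟨isUnit_norm, isUnit_det⟩, isUnit_first, isUnit_last⟩ := hy
  obtain ⟨P, u, monic_P, natDegree_P, hu, hP0, natDegree_u, cramer⟩ :=
    exists_change_root_X_mul_sq a hp hv isUnit_det
  rw [← cramer] at isUnit_first isUnit_last
  exact ⟨P, u, _, monic_P, natDegree_P, isUnit_norm, hP0, hu, natDegree_u,
    isUnit_of_mul_isUnit_right isUnit_first, isUnit_of_mul_isUnit_right isUnit_last⟩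

theorem exists_descent {p : R[X]} {v : ι → R[X]} (hp : p.Monic)
    (two_le : 2 ≤ p.natDegree) (separable_p : p.Separable) (hp0 : IsUnit (p.coeff 0))
    (hv : p ∣ formOver R[X] a v - X) :
    ∃ (g : R[X]) (u : ι → R[X]), g.Monic ∧ g.natDegree + 2 = p.natDegree ∧ IsUnit (g.coeff 0) ∧
      g ∣ formOver R[X] a u - X ∧ p.coeff 0 * g.coeff 0 ∈ valueMonoid (formOver R a) := by
  obtain ⟨P, u, r, monic_P, natDegree_P, isUnit_r, hP0, hu, natDegree_u, isUnit_zero, isUnit_top⟩ :=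
    exists_isUnit_formOver_coeff a hp two_le separable_p hp0 hv
  obtain ⟨c, g, form_u, monic_g, natDegree_g, hg0, mem⟩ := exists_residual_factor monic_P
    (by lia) hu natDegree_u isUnit_top isUnit_zero
  refine ⟨g, u, monic_g, by lia, hg0, form_u ▸ ⟨P * C c, by ring⟩, ?_⟩
  refine mem_valueMonoid_of_mul_mem (sq_mem_valueMonoid isUnit_zero isUnit_r) ?_
  rwa [← mul_assoc, mul_comm (r ^ 2), ← hP0]

theorem neg_one_pow_mul_coeff_zero_mem_valueMonoid {p : R[X]} {v : ι → R[X]} {n : ℕ}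
    (hp : p.Monic) (natDegree_p : p.natDegree = n) (hp0 : IsUnit (p.coeff 0))
    (hv : p ∣ formOver R[X] a v - X) : (-1) ^ n * p.coeff 0 ∈ valueMonoid (formOver R a) := by
  induction n using Nat.twoStepInduction generalizing p v with
  | zero =>
    rw [eq_one_of_monic_natDegree_zero hp natDegree_p, coeff_one_zero, pow_zero, mul_one]
    exact one_mem _
  | one =>
    have root_neg : p.IsRoot (-p.coeff 0) := by
      rw [hp.eq_X_add_C natDegree_p]
      simp
    have form_eq := eval_formOver_of_isRoot hv root_neg
    have mem := apply_mem_valueMonoid (form_eq.symm ▸ hp0.neg)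
    rwa [form_eq, ← neg_one_mul, ← pow_one (-1 : R)] at mem
  | more n ih _ =>
    have natDegree_ne_zero : p.natDegree ≠ 0 := by lia
    have hv' : p ∣ formOver R[X] a (fun l => v l %ₘ p) - X := by
      have dvd_sub : p ∣ formOver R[X] a (fun l => v l %ₘ p) - formOver R[X] a v :=
        dvd_formOver_sub a fun l => dvd_modByMonic_sub (v l) p
      simpa only [sub_add_sub_cancel] using dvd_add dvd_sub hv
    obtain ⟨p₁, v₁, hp₁, natDegree_p₁, separable_p₁, hp₁0, hv₁, mem⟩ :=
      exists_separable_replacement a hp natDegree_ne_zero hp0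
        (fun l => natDegree_modByMonic_lt (v l) hp fun h => natDegree_ne_zero (h ▸ natDegree_one))
        hv'
    obtain ⟨g, u, hg, natDegree_g, hg0, hu, mem'⟩ :=
      exists_descent a hp₁ (by lia) separable_p₁ hp₁0 hv₁
    have mem_g := ih hg (by lia) hg0 hu
    have neg_one_sq : ((-1) ^ n * (-1) ^ n : R) = 1 := by
      rw [← mul_pow, neg_one_mul, neg_neg, one_pow]
    have mem_p₁ : (-1) ^ n * p₁.coeff 0 ∈ valueMonoid (formOver R a) := by
      refine mem_valueMonoid_of_mul_mem mem_g ?_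
      convert! mem' using 1
      linear_combination p₁.coeff 0 * g.coeff 0 * neg_one_sq
    refine mem_valueMonoid_of_mul_mem mem_p₁ ?_
    convert! mem using 1
    linear_combination p.coeff 0 * p₁.coeff 0 * neg_one_sq

end Induction

section BaseChange

variable {R M : Type*} [CommRing R] [Invertible (2 : R)] [AddCommGroup M] [Module R M]
  {ι : Type*} [Fintype ι] [DecidableEq ι] (q : QuadraticForm R M) (m : ι → M)

theorem formOver_associated (x : ι → R) :
    formOver R (of fun i j => QuadraticMap.associated q (m i) (m j)) x = q (∑ i, x i • m i) := by
  rw [← QuadraticMap.associated_eq_self_apply R q, formOver_apply]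
  simp only [map_sum, LinearMap.sum_apply, map_smul, LinearMap.smul_apply, of_apply, smul_eq_mul,
    Algebra.algebraMap_self, RingHom.id_apply, mul_sum]
  rw [sum_comm]
  refine sum_congr rfl fun i _ => sum_congr rfl fun j _ => ?_
  ring

theorem formOver_associated_baseChange {S : Type*} [CommRing S] [Algebra R S] (s : ι → S) :
    formOver S (of fun i j => QuadraticMap.associated q (m i) (m j)) s =
      q.baseChange S (∑ i, s i ⊗ₜ[R] m i) := by
  let : Invertible (2 : S) := (Invertible.map (algebraMap R S) 2).copy 2 (map_ofNat _ _).symm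
  rw [← QuadraticMap.associated_eq_self_apply S (q.baseChange S),
    QuadraticForm.associated_baseChange, formOver_apply]
  simp only [map_sum, LinearMap.sum_apply, of_apply, LinearMap.BilinForm.baseChange_tmul,
    Algebra.algebraMap_eq_smul_one]
  rw [sum_comm]
  refine sum_congr rfl fun i _ => sum_congr rfl fun j _ => ?_
  simp [mul_comm]

theorem valueMonoid_formOver_associated_le :
    valueMonoid (formOver R (of fun i j => QuadraticMap.associated q (m i) (m j))) ≤
      valueMonoid q := by
  refine Submonoid.monotone_map (Subgroup.closure_mono ?_)
  rintro u ⟨x, hx⟩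
  exact ⟨_, (formOver_associated q m x).symm.trans hx⟩

end BaseChange

theorem norm_formOver_mem_valueMonoid {R : Type u} [CommRing R] [IsLocalRing R]
    [CharZero (IsLocalRing.ResidueField R)] {S : Type*} [CommRing S] [Algebra R S]
    {p : R[X]} (h : IsAdjoinRootMonic S p) {ι : Type} [Fintype ι] [DecidableEq ι]
    (a : Matrix ι ι R) {s : ι → S} (hs : IsUnit (formOver S a s)) :
    Algebra.norm R (formOver S a s) ∈ valueMonoid (formOver R a) := by
  obtain ⟨y, isUnit_norm, isUnit_det⟩ := exists_isUnit_norm_isUnit_basis_det h hs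
  have form_smul : formOver S a (y • s) = formOver S a s * y ^ 2 := by
    rw [QuadraticMap.map_smul, smul_eq_mul, sq, mul_comm]
  obtain ⟨P, v, monic_P, natDegree_P, hv, norm_eq, -, -⟩ :=
    exists_change_root h a (form_smul ▸ isUnit_det)
  rw [form_smul, map_mul, map_pow] at norm_eq
  have isUnit_P0 : IsUnit (P.coeff 0) := isUnit_of_mul_isUnit_right
    (norm_eq ▸ (hs.map (Algebra.norm R)).mul (isUnit_norm.pow 2))
  have mem := neg_one_pow_mul_coeff_zero_mem_valueMonoid a monic_P natDegree_P isUnit_P0 hv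
  rw [norm_eq] at mem
  refine mem_valueMonoid_of_mul_mem ?_ (mul_comm (Algebra.norm R (formOver S a s)) _ ▸ mem)
  obtain natDegree_p | natDegree_p := eq_or_ne p.natDegree 0
  · have subsingleton_S : Subsingleton S := subsingleton_of_zero_eq_one <| by
      rw [← map_one h.map]
      exact (h.map_eq_zero_iff.mpr (eq_one_of_monic_natDegree_zero h.monic natDegree_p).dvd).symm
    rw [Subsingleton.elim y 1, map_one, one_pow]
    exact one_mem _
  · obtain ⟨w, hw⟩ := (isGenericallyUnit_formOver a monic_P (natDegree_P ▸ natDegree_p) isUnit_P0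
      hv).exists_isUnit
    exact sq_mem_valueMonoid hw isUnit_norm

theorem mainTheorem1_general {R : Type u} {S M : Type*} [CommRing R] [IsLocalRing R]
    [CharZero (IsLocalRing.ResidueField R)] [CommRing S] [Algebra R S] (pb : PowerBasis R S)
    [AddCommGroup M] [Module R M] (q : QuadraticForm R M) :
    (QuadraticForm.valueGroup (q.baseChange S)).map (Units.map (Algebra.norm R : S →* R)) ≤
      QuadraticForm.valueGroup q := by
  have := Module.Finite.of_basis pb.basis
  have := Module.Free.of_basis pb.basis
  rw [QuadraticForm.valueGroup, MonoidHom.map_closure, Subgroup.closure_le]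
  rintro _ ⟨x, ⟨z, hz⟩, rfl⟩
  obtain ⟨k, s, m, rfl⟩ := TensorProduct.exists_sum_tmul_eq z
  rw [← formOver_associated_baseChange] at hz
  obtain ⟨u, hu, hux⟩ := valueMonoid_formOver_associated_le q m (norm_formOver_mem_valueMonoid
    (IsAdjoinRootMonic.mkOfAdjoinEqTop' pb.adjoin_gen_eq_top) _ (hz ▸ x.isUnit))
  rw [hz] at hux
  exact (Units.ext hux : u = Units.map (Algebra.norm R : S →* R) x) ▸ hu

theorem mainTheorem1 {R S M : Type*}
    [CommRing R] [IsDomain R] [IsLocalRing R] [CharZero (IsLocalRing.ResidueField R)]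
    [CommRing S] [Algebra R S] (n : ℕ) (hS : IsSimpleExtension R S n)
    [AddCommGroup M] [Module R M] [Module.Free R M] [Module.Finite R M]
    (q : QuadraticForm R M) (hq : q.IsRegular) :
    (QuadraticForm.valueGroup (q.baseChange S)).map (Units.map (Algebra.norm R : S →* R)) ≤
      QuadraticForm.valueGroup q := by
  obtain ⟨-, c, b, hb⟩ := hS
  exact mainTheorem1_general { gen := (c : S), dim := n, basis := b, basis_eq_pow := hb } q
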